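/- For a vector or matrix $V$ with nonnegative integer entries let $|V|$ denote the sum of its entries. For an integer $k\ge 0$ let $\omega(k)=k^k/k!$ (with $0^0=1$), and let $\Omega(V)=\prod_v \omega(v)$, the product over all entries $v$ of $V$. For $K=(k_{ij})\in\mathbb Z_{\ge0}^{m\times n}$, $R\in\mathbb Z_{\ge 0}^m$ and $C\in\mathbb Z_{\ge 0}^n$ let $T_K(R,C)$ be the number of matrices $A=(a_{ij})\in\mathbb Z_{\ge0}^{m\times n}$ with row sums $\sum_j a_{ij}=r_i$, column sums $\sum_i a_{ij}=c_j$, and $a_{ij}\le k_{ij}$ for all $i,j$. **Theorem.** Let $\alpha_1,\dots,\alpha_p\ge0$ with $\alpha_1+\cdots+\alpha_p=1$. Let $R^1,\dots,R^p\in\mathbb Z_{\ge0}^m$ and $C^1,\dots,C^p\in\mathbb Z_{\ge0}^n$ be such that $|R^1|=\cdots=|R^p|=|C^1|=\cdots=|C^p|=N$, and let $K=(k_{ij})\in\mathbb Z_{\ge0}^{m\times n}$. Suppose that $$R:=\sum_{t=1}^p\alpha_tR^t\qquad\text{and}\qquad C:=\sum_{t=1}^p\alpha_tC^t$$ have integer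 entries. Define $\tilde C^1,\dots,\tilde C^p,\tilde C$ by $$\tilde c^t_j:=\Big(\sum_{i=1}^m k_{ij}\Big)-c^t_j,\qquad \tilde c_j:=\Big(\sum_{i=1}^m k_{ij}\Big)-c_j\qquad(1\le t\le p,\ 1\le j\le n),$$ and suppose that all $\tilde c^t_j\ge 0$ (hence all $\tilde c_j\ge0$). Then $$\frac{\omega(|K|)\,T_K(R,C)}{\Omega(R)\,\Omega(\tilde C)\,\Omega(K)}\ \ge\ \prod_{t=1}^p\left[\frac{T_K(R^t,C^t)}{\min\{\Omega(R^t)\,\Omega(\tilde C^t),\ \Omega(K)\}}\right]^{\alpha_t},$$ where a factor with $\alpha_t=0$ is read as $1$. -/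

import Mathlib

namespace BoundedTables

/-- `ω(n) = n ^ n / n!`, with `ω(0) = 1`. -/
noncomputable def omega (n : ℕ) : ℝ := (n : ℝ) ^ n / (n.factorial : ℝ)

/-- `Ω(v) = ∏ ω(v_i)`, the product over all entries of the vector `v`. -/
noncomputable def vecOmega {ι : Type*} [Fintype ι] (v : ι → ℕ) : ℝ := ∏ i, omega (v i)

/-- `Ω(K) = ∏ ω(k_{ij})`, the product over all entries of the matrix `K`. -/
noncomputable def matOmega {m n : ℕ} (K : Matrix (Fin m) (Fin n) ℕ) : ℝ :=
  ∏ i, ∏ j, omega (K i j)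

/-- `|K|`, the sum of all entries of the matrix `K`. -/
def matSum {m n : ℕ} (K : Matrix (Fin m) (Fin n) ℕ) : ℕ := ∑ i, ∑ j, K i j

/-- The contingency tables with row margins `R` and column margins `C` that are bounded
entrywise by `K`. -/
def tables {m n : ℕ} (K : Matrix (Fin m) (Fin n) ℕ) (R : Fin m → ℕ) (C : Fin n → ℕ) :
    Set (Matrix (Fin m) (Fin n) ℕ) :=
  {A | (∀ i, ∑ j, A i j = R i) ∧ (∀ j, ∑ i, A i j = C j) ∧ ∀ i j, A i j ≤ K i j}

/-- The set of `K`-bounded tables is finite, so that its `Set.ncard` is its true size. -/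
theorem tables_finite {m n : ℕ} (K : Matrix (Fin m) (Fin n) ℕ) (R : Fin m → ℕ)
    (C : Fin n → ℕ) : (tables K R C).Finite := by
  have h : (Set.univ.pi fun i : Fin m => Set.univ.pi fun j : Fin n =>
      Set.Iic (K i j)).Finite :=
    Set.Finite.pi' (fun i => Set.Finite.pi' (fun j => Set.finite_Iic (K i j))) |>.subset
      (fun A hA i j => hA i (Set.mem_univ i) j (Set.mem_univ j))
  exact h.subset fun A hA i _ j _ => hA.2.2 i j

/-- `T_K(R, C)`, the number of `K`-bounded contingency tables with margins `R` and `C`. -/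
noncomputable def numTables {m n : ℕ} (K : Matrix (Fin m) (Fin n) ℕ) (R : Fin m → ℕ)
    (C : Fin n → ℕ) : ℕ := (tables K R C).ncard

/-- The complementary column margin `c̃_j = (∑ i, k_{ij}) - c_j`. It is only used for `C` with
`c_j ≤ ∑ i, k_{ij}`, where the subtraction of natural numbers is the subtraction of integers. -/
def compl {m n : ℕ} (K : Matrix (Fin m) (Fin n) ℕ) (C : Fin n → ℕ) : Fin n → ℕ :=
  fun j => (∑ i, K i j) - C j

end BoundedTables

namespace BoundedTables

/-! ### Elementary inequalities -/

/-! Bounded tables become ordinary tables on a bipartite graph: each cell is joined to its row by an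
edge carrying `a_ij` and to its column by an edge carrying `k_ij - a_ij`. The margins at the lines
are `(R, C̃)`, those at the cells are the entries of `K`, and both total `D = |K|`. The bound by `K`
is now built into the margins.

Let `T_b(x)` be the sum of `∏ x_q ^ a_q / a_q!` over the edge tables with line margins `b`
(`tableSum`). Since `x ^ a / a! * exp (-x)` is a probability density on the half-line, the number of
tables is the integral of `T_b(x) exp (-∑ x_q)`. The exponential factors combine exactly under
convex combinations, so by the Prékopa–Leindler inequality it is enough to prove the claimed
inequality pointwise: for `T_{b^t}(x^t)` on the left and `T_β(∑ α_t x^t)` on the right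
(`prod_tableSum_rpow_le`).

The pointwise inequality compares two bounds by a capacity. From above, `T_b(x) y^b v^k D^D` is at
most `min (Ω(b), Ω(k))` times the `D`-th power of the form `∑ x_q y_{ℓ q} v_{κ q}`, by expanding a
product of powers and applying AM-GM, in either of the two directions (`tableSum_mul_le_min`). The
form is linear in `x`, so a weighted geometric mean over `t` and one more AM-GM give such an
estimate at the averaged point and margin. From below, `T_β` is up to factorials a coefficient of a
product of linear forms, and Gurvits' capacity inequality for stable polynomials
(`StrictlyStable.le_coeff`) turns the estimate back into a lower bound for it, at the cost of `Ω(β)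
/ ω(D)`. -/

theorem omega_pos (n : ℕ) : 0 < omega n := by
  unfold omega
  rcases Nat.eq_zero_or_pos n with rfl | h
  · simp
  · positivity

/-- The factor `(n / (n + 1)) ^ n` is the loss in one differentiation step of the capacity bound; by
this recursion the losses telescope to `ω`. -/
theorem omega_succ_mul (n : ℕ) : omega (n + 1) * ((n : ℝ) / (n + 1)) ^ n = omega n := by
  unfold omega
  have h1 : (n.factorial : ℝ) ≠ 0 := by positivity
  have h2 : ((n : ℝ) + 1) ≠ 0 := by positivity
  rw [Nat.factorial_succ, div_pow]
  push_cast
  field_simp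
  ring

/-- The weighted inequality between the geometric and the arithmetic mean, with natural weights
and cleared denominators. -/
theorem prod_pow_mul_sum_pow_le {ι : Type*} [Fintype ι] (r : ι → ℕ) (s : ι → ℝ)
    (hs : ∀ i, 0 ≤ s i) :
    (∏ i, s i ^ r i) * ((∑ i, r i : ℕ) : ℝ) ^ (∑ i, r i) ≤
      (∏ i, (r i : ℝ) ^ r i) * (∑ i, s i) ^ (∑ i, r i) := by
  set D := ∑ i, r i with hD
  set S := ∑ i, s i with hS
  have hS0 : 0 ≤ S := Finset.sum_nonneg fun i _ => hs i
  rcases Nat.eq_zero_or_pos D with h0 | hDpos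
  · have : ∀ i, r i = 0 := fun i => by
      simpa using (Finset.sum_eq_zero_iff.mp (hD.symm.trans h0)) i (Finset.mem_univ i)
    simp [h0, this]
  have hDr : (0 : ℝ) < D := by exact_mod_cast hDpos
  rcases hS0.eq_or_lt with h0 | hSpos
  · have hs0 : ∀ i, s i = 0 := fun i =>
      (Finset.sum_eq_zero_iff_of_nonneg fun i _ => hs i).mp (hS.symm.trans h0.symm) i
        (Finset.mem_univ i)
    obtain ⟨i, hi⟩ : ∃ i, r i ≠ 0 := by
      by_contra! h
      simp [hD, h] at hDpos
    rw [Finset.prod_eq_zero (Finset.mem_univ i) (by simp [hs0, hi])]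
    rw [zero_mul]
    positivity
  -- This is `u ≤ exp (u - 1)` at `u = D s_i / (S r_i)`, the ratio of `s_i` to its value in the case
  -- of equality; the exponents sum to zero over `i`.
  have key : ∀ i, s i ^ r i ≤ ((r i : ℝ) * (S / D)) ^ r i * Real.exp (D * s i / S - r i) := by
    intro i
    rcases Nat.eq_zero_or_pos (r i) with h | h
    · simp only [h, pow_zero, one_mul, Nat.cast_zero, sub_zero]
      exact Real.one_le_exp (div_nonneg (mul_nonneg hDr.le (hs i)) hS0)
    · have hr : (0 : ℝ) < r i := by exact_mod_cast h
      have h1 : s i ≤ (r i : ℝ) * (S / D) * Real.exp (D * s i / (S * r i) - 1) := by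
        have h2 := Real.add_one_le_exp (D * s i / (S * r i) - 1)
        have h3 : s i = (r i : ℝ) * (S / D) * (D * s i / (S * r i) - 1 + 1) := by
          field_simp
          ring
        calc s i = _ := h3
          _ ≤ _ := by gcongr
      calc s i ^ r i ≤ _ := pow_le_pow_left₀ (hs i) h1 _
        _ = _ := by
          rw [mul_pow, ← Real.exp_nat_mul]
          congr 2
          field_simp
  calc (∏ i, s i ^ r i) * (D : ℝ) ^ D
      ≤ (∏ i, ((r i : ℝ) * (S / D)) ^ r i * Real.exp (D * s i / S - r i)) * (D : ℝ) ^ D := by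
        gcongr with i
        · exact fun i _ => pow_nonneg (hs i) _
        · exact key i
    _ = (∏ i, (r i : ℝ) ^ r i) * S ^ D := by
        have h1 : ∑ i, (D * s i / S - r i) = 0 := by
          rw [Finset.sum_sub_distrib, ← Finset.sum_div, ← Finset.mul_sum, ← hS, ← Nat.cast_sum,
            ← hD]
          field_simp
          ring
        rw [Finset.prod_mul_distrib, ← Real.exp_sum, h1, Real.exp_zero, mul_one]
        simp_rw [mul_pow]
        rw [Finset.prod_mul_distrib, Finset.prod_pow_eq_pow_sum, ← hD, mul_assoc, ← mul_pow,
          div_mul_cancel₀ _ hDr.ne']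

/-- AM-GM with weights `1` and `e`. It turns a lower bound by a power of `s + t` into one linear in
`t`. -/
theorem succ_mul_mul_pow_le (e : ℕ) {s t : ℝ} (hs : 0 ≤ s) (ht : 0 ≤ t) :
    (e + 1) * t * s ^ e ≤ (s + t) ^ (e + 1) * ((e : ℝ) / (e + 1)) ^ e := by
  have h := prod_pow_mul_sum_pow_le (![1, e] : Fin 2 → ℕ) (![t, s] : Fin 2 → ℝ)
    (by intro i; fin_cases i <;> simpa)
  simp only [Fin.prod_univ_two, Fin.sum_univ_two, Matrix.cons_val_zero, Matrix.cons_val_one,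
    Nat.cast_one, one_mul, pow_one] at h
  rw [add_comm 1 e, add_comm t s] at h
  push_cast at h
  rw [div_pow, mul_div_assoc', le_div_iff₀ (by positivity)]
  calc _ = t * s ^ e * ((e : ℝ) + 1) ^ (e + 1) := by ring
    _ ≤ _ := h
    _ = _ := by ring

/-- AM-GM for the factors `1 + b`, padded with ones to exactly `d` factors of mean `A`. It is proved
through `x ≤ A exp (x / A - 1)`, whose value at `x = 1` pays for each padding factor. -/
theorem multiset_prod_one_add_le {d : ℕ} (hd : 0 < d) (B : Multiset ℝ) (hB : ∀ b ∈ B, 0 ≤ b)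
    (hcard : B.card ≤ d) : (B.map fun b => 1 + b).prod ≤ (1 + B.sum / d) ^ d := by
  have hd' : (0 : ℝ) < d := by exact_mod_cast hd
  have hsum : 0 ≤ B.sum := Multiset.sum_nonneg hB
  set A : ℝ := 1 + B.sum / d with hA
  have hA0 : 0 < A := by positivity
  have hlog : ∀ x : ℝ, x ≤ A * Real.exp (x / A - 1) := fun x => by
    have h := Real.add_one_le_exp (x / A - 1)
    calc x = A * (x / A - 1 + 1) := by field_simp; ring
      _ ≤ _ := by gcongr
  have key : ∀ B : Multiset ℝ, (∀ b ∈ B, 0 ≤ b) → (B.map fun b => 1 + b).prod ≤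
      A ^ B.card * Real.exp (((B.card : ℝ) + B.sum) / A - B.card) := by
    intro B
    induction B using Multiset.induction_on with
    | empty => simp
    | cons b B ih =>
      intro h
      have hb : 0 ≤ b := h b (Multiset.mem_cons_self b B)
      have hB' : ∀ x ∈ B, 0 ≤ x := fun x hx => h x (Multiset.mem_cons_of_mem hx)
      rw [Multiset.map_cons, Multiset.prod_cons, Multiset.card_cons, Multiset.sum_cons]
      calc (1 + b) * (B.map fun b => 1 + b).prod
          ≤ (A * Real.exp ((1 + b) / A - 1)) *
            (A ^ B.card * Real.exp (((B.card : ℝ) + B.sum) / A - B.card)) := by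
            apply mul_le_mul (hlog _) (ih hB')
            · apply Multiset.prod_nonneg
              intro x hx
              obtain ⟨y, hy, rfl⟩ := Multiset.mem_map.mp hx
              have := hB' y hy
              positivity
            · positivity
        _ = A ^ (B.card + 1) * (Real.exp ((1 + b) / A - 1) *
              Real.exp (((B.card : ℝ) + B.sum) / A - B.card)) := by ring
        _ = _ := by
            rw [← Real.exp_add]
            congr 2
            push_cast
            field_simp
            ring
  obtain ⟨k, hk⟩ := Nat.exists_eq_add_of_le hcard
  have h1 := hlog 1
  have h2 : B.sum = d * (A - 1) := by rw [hA]; field_simp; ring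
  have hk' : (d : ℝ) = B.card + k := by exact_mod_cast hk
  calc _ ≤ _ := key B hB
    _ = A ^ B.card * (Real.exp (1 - 1 / A)) ^ k := by
      rw [← Real.exp_nat_mul, h2, hk']
      congr 2
      field_simp
      ring
    _ ≤ A ^ B.card * A ^ k := by
      gcongr
      rw [show (1 : ℝ) - 1 / A = -(1 / A - 1) by ring, Real.exp_neg]
      rw [inv_le_iff_one_le_mul₀ (Real.exp_pos _)]
      exact h1
    _ = A ^ d := by rw [← pow_add, ← hk]

/-- The hypothesis is strongest at `t = (d + 1) / (d S)`, which minimises the right side divided by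
`t`. For `S = 0` or `d = 0` there is no minimiser, and a large `t` gives a contradiction instead. -/
theorem le_of_forall_mul_le_pow {d : ℕ} {a S M : ℝ} (ha : 0 < a) (hS : 0 ≤ S)
    (h : ∀ t : ℝ, 0 < t → M * t ≤ a * (1 + t * S / (d + 1)) ^ (d + 1)) :
    M * ((d : ℝ) / (d + 1)) ^ d ≤ a * S := by
  rcases hS.eq_or_lt with rfl | hS
  · have hM : M ≤ 0 := by
      by_contra! hM
      have := h (2 * a / M) (by positivity)
      rw [mul_div_cancel₀ _ hM.ne'] at this
      simp at this
      linarith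
    rw [mul_zero]
    exact mul_nonpos_of_nonpos_of_nonneg hM (by positivity)
  rcases Nat.eq_zero_or_pos d with rfl | hd
  · simp only [pow_zero, mul_one]
    by_contra! hM
    have h1 := h (2 * a / (M - a * S)) (div_pos (by positivity) (by linarith))
    simp only [Nat.cast_zero, zero_add, div_one, pow_one] at h1
    have h2 : (2 * a / (M - a * S)) * (M - a * S) = 2 * a :=
      div_mul_cancel₀ _ (by linarith)
    nlinarith
  · have hd' : (0 : ℝ) < d := by exact_mod_cast hd
    have h1 := h ((d + 1) / (d * S)) (by positivity)
    have h2 : 1 + ((d : ℝ) + 1) / (d * S) * S / (d + 1) = (d + 1) / d := by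
      field_simp
    rw [h2] at h1
    have h3 : ((d : ℝ) + 1) / d * ((d : ℝ) / (d + 1)) = 1 := by field_simp
    calc M * ((d : ℝ) / (d + 1)) ^ d
        = M * (((d : ℝ) + 1) / (d * S)) * (((d : ℝ) / (d + 1)) ^ (d + 1) * S) := by
          rw [pow_succ]
          field_simp
      _ ≤ a * (((d : ℝ) + 1) / d) ^ (d + 1) * (((d : ℝ) / (d + 1)) ^ (d + 1) * S) := by
          gcongr
      _ = a * ((((d : ℝ) + 1) / d) * ((d : ℝ) / (d + 1))) ^ (d + 1) * S := by
          rw [mul_pow]; ring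
      _ = a * S := by rw [h3, one_pow, mul_one]

/-- A real-rooted polynomial `f` of degree at most `d + 1` without zeros in `[s, ∞)` and with
`f (s + t) ≥ M t` for `t > 0` satisfies `f' s ≥ M (d / (d + 1)) ^ d`. -/
theorem le_eval_derivative_of_splits {f : Polynomial ℝ} (hf : f.Splits) {d : ℕ}
    (hd : f.natDegree ≤ d + 1) {s M : ℝ} (hs : 0 < f.eval s) (hroots : ∀ x ∈ f.roots, x < s)
    (hM : ∀ t : ℝ, 0 < t → M * t ≤ f.eval (s + t)) :
    M * ((d : ℝ) / (d + 1)) ^ d ≤ f.derivative.eval s := by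
  rw [hf.eval_derivative_eq_eval_mul_sum hs.ne']
  have hB : ∀ b ∈ f.roots.map (fun z => 1 / (s - z)), 0 ≤ b := by
    intro b hb
    obtain ⟨z, hz, rfl⟩ := Multiset.mem_map.mp hb
    have := hroots z hz
    exact div_nonneg zero_le_one (by linarith)
  refine le_of_forall_mul_le_pow hs (Multiset.sum_nonneg hB) fun t ht => (hM t ht).trans ?_
  have hB' : ∀ b ∈ (f.roots.map (fun z => t * (1 / (s - z)))), 0 ≤ b := by
    intro b hb
    obtain ⟨z, hz, rfl⟩ := Multiset.mem_map.mp hb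
    have := hroots z hz
    exact mul_nonneg ht.le (div_nonneg zero_le_one (by linarith))
  have hcard : (f.roots.map (fun z => t * (1 / (s - z)))).card ≤ d + 1 := by
    rw [Multiset.card_map]
    exact (Polynomial.card_roots' f).trans hd
  have h := multiset_prod_one_add_le (Nat.succ_pos d) _ hB' hcard
  rw [Multiset.sum_map_mul_left, Multiset.map_map] at h
  push_cast at h
  refine le_trans (le_of_eq ?_) (mul_le_mul_of_nonneg_left h hs.le)
  rw [hf.eval_eq_prod_roots, hf.eval_eq_prod_roots, mul_assoc, ← Multiset.prod_map_mul]
  congr 2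
  refine Multiset.map_congr rfl fun z hz => ?_
  have := hroots z hz
  have h0 : s - z ≠ 0 := by linarith
  simp only [Function.comp]
  field_simp
  ring

end BoundedTables

namespace BoundedTables
open MvPolynomial

/-! ### Stable polynomials and the capacity bound -/

variable {σ : Type*}

/-- A real polynomial is strictly stable if it has no zeros in the closed right half-space, apart
from points whose real part vanishes. -/
def StrictlyStable (p : MvPolynomial σ ℝ) : Prop :=
  ∀ z : σ → ℂ, (∀ j, 0 ≤ (z j).re) → (∃ j, 0 < (z j).re) → aeval z p ≠ 0

/-- The univariate polynomial obtained from `p` by setting all variables except `j` to `z`. -/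
noncomputable def slice [DecidableEq σ] {S : Type*} [CommRing S] [Algebra ℝ S]
    (p : MvPolynomial σ ℝ) (z : σ → S) (j : σ) : Polynomial S :=
  aeval (Function.update (fun k => Polynomial.C (z k)) j Polynomial.X) p

section slice

variable [DecidableEq σ] {S : Type*} [CommRing S] [Algebra ℝ S]

theorem eval_slice (p : MvPolynomial σ ℝ) (z : σ → S) (j : σ) (s : S) :
    (slice p z j).eval s = aeval (Function.update z j s) p := by
  unfold slice
  induction p using MvPolynomial.induction_on with
  | C a => simp [Polynomial.algebraMap_apply]
  | add p q hp hq => simp [hp, hq]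
  | mul_X p k hp =>
    rw [map_mul, map_mul, Polynomial.eval_mul, hp, aeval_X, aeval_X]
    by_cases h : k = j
    · subst h; simp
    · simp [h]

theorem derivative_slice (p : MvPolynomial σ ℝ) (z : σ → S) (j : σ) :
    (slice p z j).derivative = slice (pderiv j p) z j := by
  unfold slice
  induction p using MvPolynomial.induction_on with
  | C a => simp [Polynomial.algebraMap_apply]
  | add p q hp hq => simp [hp, hq]
  | mul_X p k hp =>
    rw [map_mul, Polynomial.derivative_mul, hp, Derivation.leibniz, aeval_X]
    by_cases h : k = j
    · subst h; simp [mul_comm, add_comm]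
    · simp [h, pderiv_X_of_ne h, mul_comm]

theorem natDegree_slice_le {p : MvPolynomial σ ℝ} {d : ℕ} (hp : p.IsHomogeneous d) (z : σ → ℝ)
    (j : σ) : (slice p z j).natDegree ≤ d := by
  have h := aeval_natDegree_le (m := d) (n := 1) p hp.totalDegree_le
    (Function.update (fun k => Polynomial.C (z k)) j Polynomial.X) (fun k => ?_)
  · simpa [slice] using h
  · by_cases h : k = j
    · subst h
      rw [Function.update_self]
      exact Polynomial.natDegree_X_le
    · rw [Function.update_of_ne h, Polynomial.natDegree_C]
      exact zero_le_one

theorem map_slice (p : MvPolynomial σ ℝ) (y : σ → ℝ) (j : σ) :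
    (slice p y j).map (algebraMap ℝ S) = slice p (fun k => algebraMap ℝ S (y k)) j := by
  unfold slice
  induction p using MvPolynomial.induction_on with
  | C a => simp [Polynomial.algebraMap_apply]
  | add p q hp hq => simp [hp, hq]
  | mul_X p k hp =>
    rw [map_mul, map_mul, Polynomial.map_mul, hp, aeval_X, aeval_X]
    by_cases h : k = j
    · subst h; simp
    · simp [h]

end slice

theorem aeval_smul_of_isHomogeneous {S : Type*} [CommRing S] [Algebra ℝ S]
    {p : MvPolynomial σ ℝ} {d : ℕ} (hp : p.IsHomogeneous d) (r : S) (z : σ → S) :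
    aeval (fun k => r * z k) p = r ^ d * aeval z p := by
  rw [aeval_def, aeval_def, eval₂_eq, eval₂_eq, Finset.mul_sum]
  refine Finset.sum_congr rfl fun m hm => ?_
  have h : m.degree = d := by
    rw [Finsupp.degree_eq_weight_one]
    exact hp (mem_support_iff.mp hm)
  simp_rw [mul_pow]
  rw [Finset.prod_mul_distrib, Finset.prod_pow_eq_pow_sum]
  have : ∑ i ∈ m.support, m i = d := by rw [← h, Finsupp.degree_apply]
  rw [this]
  ring

theorem continuous_aeval_comp {X : Type*} [TopologicalSpace X] (p : MvPolynomial σ ℝ)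
    {f : X → σ → ℂ} (hf : ∀ k, Continuous fun x => f x k) :
    Continuous fun x => aeval (f x) p := by
  induction p using MvPolynomial.induction_on with
  | C a => simpa using continuous_const
  | add p q hp hq => simpa using! hp.add hq
  | mul_X p k hp => simpa using! hp.mul (hf k)

/-- If the slice were a constant `c`, homogeneity would give the value `r ^ (d + 1) * c` at the
point with `j`-th coordinate `1` and the others `r z_k`, for `r ≠ 0`. Letting `r → 0`, `p` would
vanish at the `j`-th unit vector, against stability. -/
theorem StrictlyStable.natDegree_slice_pos [DecidableEq σ] {p : MvPolynomial σ ℝ}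
    (hs : StrictlyStable p) {d : ℕ} (hp : p.IsHomogeneous (d + 1)) (z : σ → ℂ) (j : σ) :
    0 < (slice p z j).natDegree := by
  by_contra! h0
  have hconst := Polynomial.eq_C_of_natDegree_le_zero h0
  set c := (slice p z j).coeff 0
  have h1 : ∀ s : ℂ, aeval (Function.update z j s) p = c := fun s => by
    rw [← eval_slice, hconst, Polynomial.eval_C]
  have h2 : (fun r : ℂ => aeval (Function.update (fun k => r * z k) j 1) p) =
      fun r : ℂ => r ^ (d + 1) * c := by
    refine Continuous.ext_on (dense_compl_singleton (0 : ℂ)) ?_ (by fun_prop) ?_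
    · apply continuous_aeval_comp
      intro k
      by_cases h : k = j
      · subst h; simpa using continuous_const
      · simpa [h] using! continuous_id.mul continuous_const
    · intro r hr
      have hr : r ≠ 0 := hr
      simp only
      rw [← h1 r⁻¹, ← aeval_smul_of_isHomogeneous hp]
      congr 2
      funext k
      by_cases h : k = j
      · subst h; simp [hr]
      · simp [h]
  have h3 := congrFun h2 0
  simp only [zero_mul, ne_eq, Nat.add_eq_zero_iff, one_ne_zero, and_false, not_false_eq_true,
    zero_pow] at h3
  refine hs _ (fun k => ?_) ⟨j, ?_⟩ h3
  · by_cases h : k = j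
    · subst h; simp
    · simp [h]
  · simp

/-- Gauss–Lucas: by stability all roots of the slice through `z` have real part less than that of `z
j`, hence so do the roots of its derivative, and `z j` is not among them. -/
theorem StrictlyStable.pderiv {p : MvPolynomial σ ℝ} (hs : StrictlyStable p) {d : ℕ}
    (hp : p.IsHomogeneous (d + 1)) (j : σ) : StrictlyStable (pderiv j p) := by
  classical
  intro z hz hz' h0
  set g := slice p z j
  have hdeg : 0 < g.degree := Polynomial.natDegree_pos_iff_degree_pos.mp
    (hs.natDegree_slice_pos hp z j)
  have hd : g.derivative.eval (z j) = 0 := by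
    rw [derivative_slice, eval_slice, Function.update_eq_self, h0]
  have hg' : g.derivative ≠ 0 := by
    intro h
    rw [← Polynomial.natDegree_pos_iff_degree_pos] at hdeg
    exact hdeg.ne' (Polynomial.derivative_eq_zero.mp h)
  have hmem : z j ∈ g.derivative.rootSet ℂ := by
    rw [Polynomial.mem_rootSet, Polynomial.coe_aeval_eq_eval]
    exact ⟨hg', hd⟩
  have hsub : g.rootSet ℂ ⊆ {w | w.re < (z j).re} := by
    intro w hw
    rw [Polynomial.mem_rootSet, Polynomial.coe_aeval_eq_eval, eval_slice] at hw
    by_contra! hle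
    have hle : (z j).re ≤ w.re := by simpa using hle
    refine hs _ (fun k => ?_) ?_ hw.2
    · by_cases h : k = j
      · subst h; simpa using (hz k).trans hle
      · simpa [h] using hz k
    · obtain ⟨k, hk⟩ := hz'
      refine ⟨k, ?_⟩
      by_cases h : k = j
      · subst h; simpa using hk.trans_le hle
      · simpa [h] using hk
  have : (z j).re < (z j).re := convexHull_min hsub (convex_halfSpace_re_lt _)
    (Polynomial.rootSet_derivative_subset_convexHull_rootSet hdeg hmem)
  exact lt_irrefl _ this

/-- The zeros of a slice of a stable homogeneous polynomial through a positive point are real and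
not positive. -/
theorem StrictlyStable.root_slice [DecidableEq σ] {p : MvPolynomial σ ℝ} (hs : StrictlyStable p)
    {d : ℕ} (hp : p.IsHomogeneous d) {y : σ → ℝ} (hy : ∀ k, 0 < y k) (j : σ) {w : ℂ}
    (hw : (slice p (fun k => (y k : ℂ)) j).eval w = 0) : w.im = 0 ∧ w.re ≤ 0 := by
  by_contra hcon
  have hpos : 0 < ‖w‖ + w.re := by
    have h1 := Complex.abs_re_le_norm w
    have h2 := neg_abs_le w.re
    rcases (by linarith : 0 ≤ ‖w‖ + w.re).eq_or_lt with h | h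
    · exfalso
      apply hcon
      have h3 : |w.re| = ‖w‖ := le_antisymm h1 (by linarith)
      have h4 : w.re ≤ 0 := by have := norm_nonneg w; linarith
      exact ⟨by rwa [Complex.abs_re_eq_norm] at h3, h4⟩
    · exact h
  have hw0 : 0 < ‖w‖ := by
    rw [norm_pos_iff]
    rintro rfl
    simp at hpos
  rw [eval_slice] at hw
  -- Unless `w` is real and nonpositive, both `ζ` and `ζ w` have positive real part. Scaling by `ζ`
  -- moves the zero into the region forbidden by stability.
  set ζ : ℂ := (‖w‖ : ℂ) + (starRingEnd ℂ) w with hζ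
  have hζre : ζ.re = ‖w‖ + w.re := by simp [hζ]
  have hζw : (ζ * w).re = ‖w‖ * (‖w‖ + w.re) := by
    have h : (starRingEnd ℂ) w * w = ((‖w‖ ^ 2 : ℝ) : ℂ) := by
      rw [mul_comm, Complex.mul_conj, Complex.normSq_eq_norm_sq]
    rw [hζ, add_mul, h, Complex.add_re, Complex.ofReal_re, Complex.re_ofReal_mul]
    ring
  have hall : ∀ k, 0 < (ζ * Function.update (fun k => (y k : ℂ)) j w k).re := by
    intro k
    by_cases h : k = j
    · subst h
      rw [Function.update_self, hζw]
      positivity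
    · rw [Function.update_of_ne h, Complex.re_mul_ofReal, hζre]
      exact mul_pos hpos (hy k)
  refine hs _ (fun k => (hall k).le) ⟨j, hall j⟩ ?_
  rw [aeval_smul_of_isHomogeneous hp, hw, mul_zero]

/-- The capacity bound for coefficients of stable polynomials. -/
theorem StrictlyStable.le_coeff [Fintype σ] {d : ℕ} {p : MvPolynomial σ ℝ}
    (hs : StrictlyStable p) (hp : p.IsHomogeneous d) (β : σ →₀ ℕ) (hβ : ∑ j, β j = d) {c : ℝ}
    (hc : 0 < c) (h : ∀ y : σ → ℝ, (∀ j, 0 < y j) → c * ∏ j, y j ^ β j ≤ aeval y p) :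
    c * ((∏ j, omega (β j)) / omega d) ≤ coeff β p := by
  classical
  induction d generalizing p β c with
  | zero =>
    have hβ0 : β = 0 := by
      ext j
      exact (Finset.sum_eq_zero_iff.mp hβ) j (Finset.mem_univ j)
    subst hβ0
    have h1 := h (fun _ => 1) fun _ => one_pos
    rw [← totalDegree_zero_iff_isHomogeneous, totalDegree_eq_zero_iff_eq_C] at hp
    rw [hp] at h1
    simpa [omega] using h1
  | succ d ih =>
    obtain ⟨j, hj⟩ : ∃ j, β j ≠ 0 := by
      by_contra! h0
      simp [h0] at hβ
    obtain ⟨e, he⟩ := Nat.exists_eq_succ_of_ne_zero hj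
    set β' : σ →₀ ℕ := β - Finsupp.single j 1 with hβ'
    have hββ' : β = β' + Finsupp.single j 1 := by
      rw [hβ', tsub_add_cancel_of_le]
      rw [Finsupp.single_le_iff]
      omega
    have hβ'j : β' j = e := by rw [hβ']; simp [he]
    have hβ'k : ∀ k, k ≠ j → β' k = β k := fun k hk => by
      rw [hβ']; simp [hk.symm]
    have hsum' : ∑ k, β' k = d := by
      have h1 : ∑ k, β k = ∑ k, β' k + 1 := by
        rw [hββ']
        simp [Finset.sum_add_distrib, Finsupp.single_apply]
      omega
    have hp' : (MvPolynomial.pderiv j p).IsHomogeneous d := by simpa using hp.pderiv (i := j)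
    set κ : ℝ := ((d : ℝ) / (d + 1)) ^ d with hκ
    set lam : ℝ := ((e : ℝ) / (e + 1)) ^ e with hlam
    have hκ0 : 0 < κ := by
      rcases Nat.eq_zero_or_pos d with h0 | h0
      · simp [hκ, h0]
      · positivity
    have hlam0 : 0 < lam := by
      rcases Nat.eq_zero_or_pos e with h0 | h0
      · simp [hlam, h0]
      · positivity
    -- Differentiation multiplies the coefficient by `e + 1`. The factors `κ` and `1 / lam` change
    -- `ω (d + 1)` into `ω d` and `ω (e + 1)` into `ω e`.
    have hstep := ih (hs.pderiv hp j) hp' β' hsum' (c := c * (e + 1) / lam * κ) (by positivity) ?_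
    · rw [coeff_pderiv, ← hββ', hβ'j] at hstep
      have h1 : ∏ k, omega (β k) = (∏ k, omega (β' k)) / lam := by
        rw [Fintype.prod_eq_mul_prod_compl j, Fintype.prod_eq_mul_prod_compl j, he, hβ'j,
          ← omega_succ_mul e, ← hlam]
        have : ∏ k ∈ {j}ᶜ, omega (β k) = ∏ k ∈ {j}ᶜ, omega (β' k) :=
          Finset.prod_congr rfl fun k hk => by rw [hβ'k k (by simpa using hk)]
        rw [this]
        field_simp
      have h2 := omega_succ_mul d
      rw [← hκ] at h2
      rw [h1, ← mul_le_mul_iff_left₀ (by positivity : (0 : ℝ) < e + 1)]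
      refine le_trans (le_of_eq ?_) hstep
      have := omega_pos (d + 1)
      rw [← h2]
      field_simp
    · intro y hy
      set f := slice p y j with hf
      have hmap : f.map (algebraMap ℝ ℂ) = slice p (fun k => (y k : ℂ)) j := map_slice p y j
      have hcroots : ∀ w ∈ (f.map (algebraMap ℝ ℂ)).roots, w.im = 0 ∧ w.re ≤ 0 := by
        intro w hw
        rw [hmap] at hw
        exact hs.root_slice hp hy j (Polynomial.isRoot_of_mem_roots hw)
      have hsplit : f.Splits := by
        refine Polynomial.Splits.of_splits_map (algebraMap ℝ ℂ) (IsAlgClosed.splits _) ?_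
        intro w hw
        exact ⟨w.re, Complex.ext (by simp) (by simp [(hcroots w hw).1])⟩
      have hroots : ∀ x ∈ f.roots, x < y j := by
        intro x hx
        have : (x : ℂ) ∈ (f.map (algebraMap ℝ ℂ)).roots := by
          rw [hsplit.roots_map]
          exact Multiset.mem_map_of_mem _ hx
        have h1 := (hcroots _ this).2
        rw [Complex.ofReal_re] at h1
        exact h1.trans_lt (hy j)
      have hlow : ∀ s : ℝ, 0 < s → c * (s ^ (e + 1) * ∏ k ∈ {j}ᶜ, y k ^ β k) ≤ f.eval s := by
        intro s hs'
        rw [hf, eval_slice]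
        refine le_trans (le_of_eq ?_) (h (Function.update y j s) fun k => ?_)
        · rw [Fintype.prod_eq_mul_prod_compl j, Function.update_self, he]
          congr 2
          refine Finset.prod_congr rfl fun k hk => ?_
          rw [Function.update_of_ne (by simpa using hk)]
        · by_cases hk : k = j
          · subst hk; simpa using hs'
          · simpa [hk] using hy k
      have hprod0 : 0 < ∏ k ∈ {j}ᶜ, y k ^ β k := Finset.prod_pos fun k _ => pow_pos (hy k) _
      have hfpos : 0 < f.eval (y j) := lt_of_lt_of_le
        (mul_pos hc (mul_pos (pow_pos (hy j) _) hprod0)) (hlow _ (hy j))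
      -- The slope `M` comes from applying `succ_mul_mul_pow_le` to the capacity bound at `y j + t`.
      have hmain := le_eval_derivative_of_splits hsplit (natDegree_slice_le hp y j) hfpos hroots
        (M := c * (e + 1) / lam * (y j ^ e * ∏ k ∈ {j}ᶜ, y k ^ β k)) ?_
      · rw [hf, derivative_slice, eval_slice, Function.update_eq_self] at hmain
        refine le_trans (le_of_eq ?_) hmain
        rw [Fintype.prod_eq_mul_prod_compl j, hβ'j, Finset.prod_congr rfl fun k hk => by
          rw [hβ'k k (by simpa using hk)]]
        ring
      · intro t ht
        refine le_trans ?_ (hlow (y j + t) (add_pos (hy j) ht))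
        have h1 := succ_mul_mul_pow_le e (hy j).le ht.le
        rw [← hlam] at h1
        rw [div_mul_eq_mul_div, div_mul_eq_mul_div, div_le_iff₀ hlam0]
        calc _ = c * (∏ k ∈ {j}ᶜ, y k ^ β k) * ((e + 1) * t * y j ^ e) := by ring
          _ ≤ c * (∏ k ∈ {j}ᶜ, y k ^ β k) * ((y j + t) ^ (e + 1) * lam) := by gcongr
          _ = _ := by ring

/-- The capacity bound for coefficients of products of linear forms with nonnegative
coefficients, which contains van der Waerden's bound for permanents. -/
theorem le_coeff_prod_linear_pow [Fintype σ] {ι : Type*} [Fintype ι] (a : ι → σ → ℝ)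
    (ha : ∀ i j, 0 ≤ a i j) (k : ι → ℕ) (β : σ →₀ ℕ) (hβ : ∑ j, β j = ∑ i, k i) {c : ℝ}
    (hc : 0 < c) (h : ∀ y : σ → ℝ, (∀ j, 0 < y j) →
      c * ∏ j, y j ^ β j ≤ ∏ i, (∑ j, a i j * y j) ^ k i) :
    c * ((∏ j, omega (β j)) / omega (∑ i, k i)) ≤
      coeff β (∏ i, (∑ j, C (a i j) * X j) ^ k i) := by
  classical
  -- Zero coefficients can destroy strict stability. Adding `ε > 0` restores it and only raises the
  -- values at positive points; then `ε → 0`.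
  set P : ℝ → MvPolynomial σ ℝ := fun ε => ∏ i, (∑ j, C (a i j + ε) * X j) ^ k i with hP
  have hcont : Continuous fun ε => coeff β (P ε) := by
    have hmul : ∀ p q : ℝ → MvPolynomial σ ℝ, (∀ γ, Continuous fun ε => coeff γ (p ε)) →
        (∀ γ, Continuous fun ε => coeff γ (q ε)) →
        ∀ γ, Continuous fun ε => coeff γ (p ε * q ε) := by
      intro p q hp hq γ
      simp_rw [coeff_mul]
      exact continuous_finsetSum _ fun x _ => (hp _).mul (hq _)
    have hpow : ∀ (p : ℝ → MvPolynomial σ ℝ) (l : ℕ), (∀ γ, Continuous fun ε => coeff γ (p ε)) →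
        ∀ γ, Continuous fun ε => coeff γ (p ε ^ l) := by
      intro p l hp
      induction l with
      | zero => intro γ; simpa using continuous_const
      | succ l ih => simpa only [pow_succ] using hmul _ _ ih hp
    have hprod : ∀ s : Finset ι, ∀ γ,
        Continuous fun ε => coeff γ (∏ i ∈ s, (∑ j, C (a i j + ε) * X j : MvPolynomial σ ℝ) ^ k i)
        := by
      intro s
      induction s using Finset.induction_on with
      | empty => intro γ; simpa using continuous_const
      | insert i s his ih =>
        simp only [Finset.prod_insert his]
        refine hmul _ _ (hpow _ _ fun γ => ?_) ih
        simp only [coeff_sum, coeff_C_mul]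
        fun_prop
    exact hprod _ β
  have hlin : ∀ ε i, (∑ j, C (a i j + ε) * X j : MvPolynomial σ ℝ).IsHomogeneous 1 := fun ε i =>
    IsHomogeneous.sum _ _ _ fun j _ => by
      simpa using (isHomogeneous_C σ (a i j + ε)).mul (isHomogeneous_X ℝ j)
  have hhom : ∀ ε, (P ε).IsHomogeneous (∑ i, k i) := fun ε =>
    IsHomogeneous.prod _ _ _ fun i _ => by simpa using (hlin ε i).pow (k i)
  have hstab : ∀ ε, 0 < ε → StrictlyStable (P ε) := by
    intro ε hε z hz hz'
    simp only [hP, map_prod, map_pow, map_sum, map_mul, aeval_X, aeval_C]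
    refine Finset.prod_ne_zero_iff.mpr fun i _ => pow_ne_zero _ fun h0 => ?_
    have h1 := congrArg Complex.re h0
    rw [Complex.re_sum] at h1
    simp only [Complex.coe_algebraMap, Complex.re_ofReal_mul, Complex.zero_re] at h1
    obtain ⟨j, hj⟩ := hz'
    refine (Finset.sum_pos' (fun j _ => ?_) ⟨j, Finset.mem_univ j, ?_⟩).ne' h1
    · exact mul_nonneg (add_nonneg (ha i j) hε.le) (hz j)
    · exact mul_pos (add_pos_of_nonneg_of_pos (ha i j) hε) hj
  have hε : ∀ ε, 0 < ε → c * ((∏ j, omega (β j)) / omega (∑ i, k i)) ≤ coeff β (P ε) := by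
    intro ε hε
    refine (hstab ε hε).le_coeff (hhom ε) β hβ hc fun y hy => (h y hy).trans ?_
    simp only [hP, map_prod, map_pow, map_sum, map_mul, aeval_X, aeval_C, Algebra.algebraMap_self,
      RingHom.id_apply]
    refine Finset.prod_le_prod (fun i _ => pow_nonneg (Finset.sum_nonneg fun j _ =>
      mul_nonneg (ha i j) (hy j).le) _) fun i _ => ?_
    refine pow_le_pow_left₀ (Finset.sum_nonneg fun j _ => mul_nonneg (ha i j) (hy j).le) ?_ _
    refine Finset.sum_le_sum fun j _ => ?_
    have := (hy j).le
    gcongr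
    linarith
  have hlim := ge_of_tendsto (hcont.continuousWithinAt (s := Set.Ioi 0) (x := 0))
    (Filter.eventually_of_mem self_mem_nhdsWithin fun ε hε' => hε ε hε')
  simpa [hP] using hlim

end BoundedTables

namespace BoundedTables
open MeasureTheory
open scoped ENNReal Pointwise

/-! ### The Prékopa–Leindler inequality -/

/-- With `a = max A` and `b = min B`, the translates `b + A` and `a + B` lie in `A + B` and meet
only in `a + b`. -/
theorem volume_add_volume_le_of_isCompact {A B : Set ℝ} (hA : IsCompact A) (hB : IsCompact B)
    (hA' : A.Nonempty) (hB' : B.Nonempty) : volume A + volume B ≤ volume (A + B) := by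
  set a := sSup A
  set b := sInf B
  have ha : a ∈ A := hA.sSup_mem hA'
  have hb : b ∈ B := hB.sInf_mem hB'
  have h1 : volume ((fun x => b + x) '' A) = volume A := by
    rw [Set.image_add_left]; simp
  have h2 : volume ((fun x => a + x) '' B) = volume B := by
    rw [Set.image_add_left]; simp
  have hcA : IsCompact ((fun x => b + x) '' A) := hA.image (continuous_const.add continuous_id)
  have hcB : IsCompact ((fun x => a + x) '' B) := hB.image (continuous_const.add continuous_id)
  have hdisj : AEDisjoint volume ((fun x => b + x) '' A) ((fun x => a + x) '' B) := by
    refine measure_mono_null (t := {a + b}) ?_ (by simp)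
    rintro x ⟨⟨y, hy, rfl⟩, z, hz, hyz⟩
    have h3 : y ≤ a := le_csSup hA.bddAbove hy
    have h4 : b ≤ z := csInf_le hB.bddBelow hz
    simp only at hyz
    simp only [Set.mem_singleton_iff]
    linarith
  rw [← h1, ← h2, ← measure_union₀ hcB.measurableSet.nullMeasurableSet hdisj]
  refine measure_mono (Set.union_subset ?_ ?_)
  · rintro _ ⟨y, hy, rfl⟩
    exact ⟨y, hy, b, hb, add_comm _ _⟩
  · rintro _ ⟨z, hz, rfl⟩
    exact ⟨a, ha, z, hz, rfl⟩

variable {τ : Type*}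

theorem exists_isCompact_sum_volume_le (s : Finset τ) (A : τ → Set ℝ) (hA : ∀ t, IsCompact (A t))
    (hA' : ∀ t, (A t).Nonempty) : ∃ S : Set ℝ, IsCompact S ∧ S.Nonempty ∧
      ∑ t ∈ s, volume (A t) ≤ volume S ∧
      ∀ x ∈ S, ∃ a : τ → ℝ, (∀ t ∈ s, a t ∈ A t) ∧ x = ∑ t ∈ s, a t := by
  classical
  induction s using Finset.induction_on with
  | empty => exact ⟨{0}, isCompact_singleton, Set.singleton_nonempty 0, by simp,
      fun x hx => ⟨0, by simp, by simpa using hx⟩⟩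
  | insert t s hts ih =>
    obtain ⟨S, hS, hS', hle, hmem⟩ := ih
    refine ⟨A t + S, (hA t).add hS, (hA' t).add hS', ?_, ?_⟩
    · rw [Finset.sum_insert hts]
      exact (add_le_add_right hle _).trans
        (volume_add_volume_le_of_isCompact (hA t) hS (hA' t) hS')
    · rintro _ ⟨y, hy, z, hz, rfl⟩
      obtain ⟨a, ha, rfl⟩ := hmem z hz
      refine ⟨Function.update a t y, fun u hu => ?_, ?_⟩
      · by_cases h : u = t
        · subst h; simpa using hy
        · simpa [h] using ha u (Finset.mem_of_mem_insert_of_ne hu h)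
      · rw [Finset.sum_insert hts, Function.update_self]
        congr 1
        refine Finset.sum_congr rfl fun u hu => ?_
        rw [Function.update_of_ne]
        rintro rfl
        exact hts hu

/-- Inner regularity. A fixed point of `A` is added to each compact set to keep it nonempty, as
Brunn–Minkowski requires. -/
theorem exists_seq_isCompact_tendsto_volume {A : Set ℝ} (hA : MeasurableSet A)
    (hA' : A.Nonempty) : ∃ u : ℕ → Set ℝ, (∀ n, IsCompact (u n)) ∧ (∀ n, (u n).Nonempty) ∧
      (∀ n, u n ⊆ A) ∧ Filter.Tendsto (fun n => volume (u n)) Filter.atTop (nhds (volume A)) := by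
  set T : Set ℝ≥0∞ := {v | ∃ K, IsCompact K ∧ K.Nonempty ∧ K ⊆ A ∧ volume K = v}
  obtain ⟨x, hx⟩ := hA'
  have hsup : sSup T = volume A := by
    refine le_antisymm (sSup_le ?_) ?_
    · rintro _ ⟨K, -, -, hK, rfl⟩
      exact measure_mono hK
    · rw [hA.measure_eq_iSup_isCompact]
      refine iSup₂_le fun K hK => iSup_le fun hKc => ?_
      refine le_trans (measure_mono (Set.subset_insert x K)) (le_sSup ?_)
      exact ⟨insert x K, hKc.insert x, Set.insert_nonempty _ _, Set.insert_subset hx hK, rfl⟩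
  obtain ⟨v, -, hv, hvT⟩ := exists_seq_tendsto_sSup (S := T)
    ⟨_, {x}, isCompact_singleton, Set.singleton_nonempty x, by simpa using hx, rfl⟩
    (OrderTop.bddAbove T)
  choose u hu using hvT
  refine ⟨u, fun n => (hu n).1, fun n => (hu n).2.1, fun n => (hu n).2.2.1, ?_⟩
  rw [← hsup]
  exact hv.congr fun n => (hu n).2.2.2.symm

/-- Nonzero limits are assumed because multiplication on `ℝ≥0∞` is discontinuous at `(0, ∞)`. -/
theorem tendsto_finsetProd_of_ne_zero (s : Finset τ) (u : τ → ℕ → ℝ≥0∞) (v : τ → ℝ≥0∞)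
    (hu : ∀ t, Filter.Tendsto (u t) Filter.atTop (nhds (v t))) (hv : ∀ t, v t ≠ 0) :
    Filter.Tendsto (fun n => ∏ t ∈ s, u t n) Filter.atTop (nhds (∏ t ∈ s, v t)) := by
  classical
  induction s using Finset.induction_on with
  | empty => simp
  | insert t s hts ih =>
    simp only [Finset.prod_insert hts]
    exact ENNReal.Tendsto.mul (hu t) (Or.inl (hv t)) ih
      (Or.inl (Finset.prod_ne_zero_iff.mpr fun t _ => hv t))

variable [Fintype τ]

/-- The Brunn–Minkowski inequality on the line. -/
theorem sum_mul_volume_le (α : τ → ℝ) (hα : ∀ t, 0 < α t) (A : τ → Set ℝ)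
    (hA : ∀ t, MeasurableSet (A t)) (hA' : ∀ t, (A t).Nonempty) (B : Set ℝ)
    (hB : ∀ a : τ → ℝ, (∀ t, a t ∈ A t) → ∑ t, α t * a t ∈ B) :
    ∑ t, ENNReal.ofReal (α t) * volume (A t) ≤ volume B := by
  choose u hu1 hu2 hu3 hu4 using fun t => exists_seq_isCompact_tendsto_volume (hA t) (hA' t)
  have hlim : Filter.Tendsto (fun n => ∑ t, ENNReal.ofReal (α t) * volume (u t n)) Filter.atTop
      (nhds (∑ t, ENNReal.ofReal (α t) * volume (A t))) :=
    tendsto_finsetSum _ fun t _ =>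
      ENNReal.Tendsto.const_mul (hu4 t) (Or.inr ENNReal.ofReal_ne_top)
  refine le_of_tendsto' hlim fun n => ?_
  obtain ⟨S, -, -, hle, hmem⟩ := exists_isCompact_sum_volume_le Finset.univ
    (fun t => α t • u t n) (fun t => (hu1 t n).smul (α t)) (fun t => (hu2 t n).smul_set)
  have hvol : ∀ t, volume (α t • u t n) = ENNReal.ofReal (α t) * volume (u t n) := fun t => by
    rw [Measure.addHaar_smul]
    simp [abs_of_pos (hα t)]
  simp_rw [hvol] at hle
  refine hle.trans (measure_mono fun x hx => ?_)
  obtain ⟨a, ha, rfl⟩ := hmem x hx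
  choose b hb hab using fun t => ha t (Finset.mem_univ t)
  have := hB b fun t => hu3 t n (hb t)
  simpa only [← hab, smul_eq_mul] using this

theorem ennreal_geom_mean_le_arith_mean (α : τ → ℝ) (hα : ∀ t, 0 < α t) (hα1 : ∑ t, α t = 1)
    (x : τ → ℝ≥0∞) : ∏ t, x t ^ α t ≤ ∑ t, ENNReal.ofReal (α t) * x t := by
  by_cases hx : ∃ t, x t = ∞
  · obtain ⟨t, ht⟩ := hx
    have : ∑ t, ENNReal.ofReal (α t) * x t = ∞ := by
      rw [ENNReal.sum_eq_top]
      refine ⟨t, Finset.mem_univ t, ?_⟩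
      rw [ht, ENNReal.mul_top]
      simpa using hα t
    rw [this]
    exact le_top
  · push Not at hx
    lift x to τ → NNReal using hx
    have h := NNReal.geom_mean_le_arith_mean_weighted Finset.univ (fun t => (α t).toNNReal) x
      (by
        rw [← Real.toNNReal_sum_of_nonneg fun t _ => (hα t).le, hα1, Real.toNNReal_one])
    have h' : ((∏ t, x t ^ ((α t).toNNReal : ℝ) : NNReal) : ℝ≥0∞) ≤
      ((∑ t, (α t).toNNReal * x t : NNReal) : ℝ≥0∞) := by exact_mod_cast h
    push_cast at h'
    refine le_trans (le_of_eq ?_) h'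
    refine Finset.prod_congr rfl fun t _ => ?_
    rw [ENNReal.coe_rpow_of_nonneg _ (by positivity), Real.coe_toNNReal _ (hα t).le]

/-- The measure `μ` satisfies the Prékopa–Leindler inequality for the weights `α`. -/
def HasPrekopaLeindler {E : Type*} [AddCommGroup E] [Module ℝ E] [MeasurableSpace E]
    (α : τ → ℝ) (μ : Measure E) : Prop :=
  ∀ (f : τ → E → ℝ≥0∞) (h : E → ℝ≥0∞), (∀ t, Measurable (f t)) → Measurable h →
    (∀ x : τ → E, ∏ t, f t (x t) ^ α t ≤ h (∑ t, α t • x t)) →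
    ∏ t, (∫⁻ x, f t x ∂μ) ^ α t ≤ ∫⁻ x, h x ∂μ

theorem prod_const_mul_rpow (α : τ → ℝ) (hα : ∀ t, 0 < α t) (c x : τ → ℝ≥0∞) :
    ∏ t, (c t * x t) ^ α t = (∏ t, c t ^ α t) * ∏ t, x t ^ α t := by
  rw [← Finset.prod_mul_distrib]
  exact Finset.prod_congr rfl fun t _ => ENNReal.mul_rpow_of_nonneg _ _ (hα t).le

theorem prod_rpow_eq_self (α : τ → ℝ) (hα : ∀ t, 0 < α t) (hα1 : ∑ t, α t = 1) (c : ℝ≥0∞) :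
    ∏ t, c ^ α t = c := by
  classical
  have h : ∀ s : Finset τ, ∏ t ∈ s, c ^ α t = c ^ ∑ t ∈ s, α t := by
    intro s
    induction s using Finset.induction_on with
    | empty => simp
    | insert t s hts ih =>
      rw [Finset.prod_insert hts, Finset.sum_insert hts, ih,
        ENNReal.rpow_add_of_nonneg _ _ (hα t).le (Finset.sum_nonneg fun t _ => (hα t).le)]
  rw [h, hα1, ENNReal.rpow_one]

/-- With all suprema equal to `1`, the superlevel sets of every `g t` are nonempty at exactly the
same levels `r < 1`. Brunn–Minkowski at each level, integrated over `r`, even bounds the arithmetic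
mean of the integrals. -/
theorem prekopaLeindler_of_iSup_eq_one (α : τ → ℝ) (hα : ∀ t, 0 < α t) (hα1 : ∑ t, α t = 1)
    (g : τ → ℝ → ℝ≥0∞) (h : ℝ → ℝ≥0∞) (hg : ∀ t, Measurable (g t)) (hh : Measurable h)
    (hsup : ∀ t, ⨆ x, g t x = 1)
    (hgh : ∀ x : τ → ℝ, ∏ t, g t (x t) ^ α t ≤ h (∑ t, α t * x t)) :
    ∏ t, (∫⁻ x, g t x) ^ α t ≤ ∫⁻ x, h x := by
  have hg1 : ∀ t x, g t x ≤ 1 := fun t x => (le_iSup (g t) x).trans (hsup t).le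
  have hgt : ∀ t x, g t x ≠ ∞ := fun t x => ne_top_of_le_ne_top ENNReal.one_ne_top (hg1 t x)
  -- Only levels below `1` matter; truncation makes the function finite, as the real-valued
  -- layer-cake formula requires.
  set k : ℝ → ℝ≥0∞ := fun x => min (h x) 1
  have hk : Measurable k := hh.min measurable_const
  have hkt : ∀ x, k x ≠ ∞ := fun x => ne_top_of_le_ne_top ENNReal.one_ne_top (min_le_right _ _)
  have hlayer_g : ∀ t, ∫⁻ x, g t x =
      ∫⁻ r in Set.Ioi (0 : ℝ), volume {x | r < (g t x).toReal} := fun t => by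
    rw [← lintegral_eq_lintegral_meas_lt volume
      (Filter.Eventually.of_forall fun x => ENNReal.toReal_nonneg) (hg t).ennreal_toReal.aemeasurable]
    exact lintegral_congr fun x => (ENNReal.ofReal_toReal (hgt t x)).symm
  have hlayer_k : ∫⁻ x, k x = ∫⁻ r in Set.Ioi (0 : ℝ), volume {x | r ≤ (k x).toReal} := by
    rw [← lintegral_eq_lintegral_meas_le volume
      (Filter.Eventually.of_forall fun x => ENNReal.toReal_nonneg) hk.ennreal_toReal.aemeasurable]
    exact lintegral_congr fun x => (ENNReal.ofReal_toReal (hkt x)).symm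
  have hanti : ∀ t, Measurable fun r : ℝ => volume {x | r < (g t x).toReal} := fun t =>
    Antitone.measurable fun r s hrs => measure_mono fun x (hx : s < _) => hrs.trans_lt hx
  calc ∏ t, (∫⁻ x, g t x) ^ α t ≤ ∑ t, ENNReal.ofReal (α t) * ∫⁻ x, g t x :=
        ennreal_geom_mean_le_arith_mean α hα hα1 _
    _ = ∫⁻ r in Set.Ioi (0 : ℝ), ∑ t, ENNReal.ofReal (α t) * volume {x | r < (g t x).toReal} := by
        rw [lintegral_finsetSum _ fun t _ => (hanti t).const_mul _]
        refine Finset.sum_congr rfl fun t _ => ?_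
        rw [lintegral_const_mul _ (hanti t), hlayer_g]
    _ ≤ ∫⁻ r in Set.Ioi (0 : ℝ), volume {x | r ≤ (k x).toReal} := by
        refine setLIntegral_mono' measurableSet_Ioi fun r (hr : 0 < r) => ?_
        rcases lt_or_ge r 1 with hr1 | hr1
        · refine sum_mul_volume_le α hα _
            (fun t => measurableSet_lt measurable_const (hg t).ennreal_toReal) (fun t => ?_) _ ?_
          · have : ENNReal.ofReal r < ⨆ x, g t x := by
              rw [hsup]; simpa using hr1
            obtain ⟨x, hx⟩ := lt_iSup_iff.mp this
            exact ⟨x, (ENNReal.ofReal_lt_iff_lt_toReal hr.le (hgt t x)).mp hx⟩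
          · intro a ha
            have h1 : ENNReal.ofReal r ≤ h (∑ t, α t * a t) := by
              refine le_trans ?_ (hgh a)
              rw [← prod_rpow_eq_self α hα hα1 (ENNReal.ofReal r)]
              refine Finset.prod_le_prod' fun t _ => ENNReal.rpow_le_rpow ?_ (hα t).le
              exact ((ENNReal.ofReal_lt_iff_lt_toReal hr.le (hgt t _)).mpr (ha t)).le
            have h2 : ENNReal.ofReal r ≤ k (∑ t, α t * a t) :=
              le_min h1 (by simpa using hr1.le)
            exact (ENNReal.ofReal_le_iff_le_toReal (hkt _)).mp h2
        · have : ∀ t, {x | r < (g t x).toReal} = ∅ := fun t => by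
            ext x
            simp only [Set.mem_ofPred_eq, Set.mem_empty_iff_false, iff_false, not_lt]
            exact (ENNReal.toReal_mono ENNReal.one_ne_top (hg1 t x)).trans (by simpa using hr1)
          simp [this]
    _ = ∫⁻ x, k x := hlayer_k.symm
    _ ≤ ∫⁻ x, h x := lintegral_mono fun x => min_le_left _ _

/-- The inequality is homogeneous: divide each `f t` by its supremum `M t` and `h` by `∏ M t ^ α t`.
-/
theorem prekopaLeindler_of_iSup_ne_top (α : τ → ℝ) (hα : ∀ t, 0 < α t) (hα1 : ∑ t, α t = 1)
    (f : τ → ℝ → ℝ≥0∞) (h : ℝ → ℝ≥0∞) (hf : ∀ t, Measurable (f t)) (hh : Measurable h)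
    (hsup : ∀ t, ⨆ x, f t x ≠ ∞)
    (hfh : ∀ x : τ → ℝ, ∏ t, f t (x t) ^ α t ≤ h (∑ t, α t * x t)) :
    ∏ t, (∫⁻ x, f t x) ^ α t ≤ ∫⁻ x, h x := by
  set M : τ → ℝ≥0∞ := fun t => ⨆ x, f t x with hM
  by_cases h0 : ∃ t, M t = 0
  · obtain ⟨t, ht⟩ := h0
    have : ∀ x, f t x = 0 := fun x => le_antisymm ((le_iSup (f t) x).trans ht.le) zero_le
    rw [Finset.prod_eq_zero (Finset.mem_univ t)]
    · exact zero_le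
    · simp [this, hα t]
  push Not at h0
  set m := ∏ t, M t ^ α t with hm
  have hm0 : m ≠ 0 := Finset.prod_ne_zero_iff.mpr fun t _ => by
    simp [ENNReal.rpow_eq_zero_iff, h0 t, (hα t).le]
  have hmt : m ≠ ∞ := ENNReal.prod_ne_top fun t _ =>
    ENNReal.rpow_ne_top_of_nonneg (hα t).le (hsup t)
  have hcancel : ∀ t (y : ℝ≥0∞), M t * ((M t)⁻¹ * y) = y := fun t y => by
    rw [← mul_assoc, ENNReal.mul_inv_cancel (h0 t) (hsup t), one_mul]
  have key := prekopaLeindler_of_iSup_eq_one α hα hα1 (fun t x => (M t)⁻¹ * f t x)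
    (fun x => m⁻¹ * h x) (fun t => (hf t).const_mul _) (hh.const_mul _) (fun t => ?_) (fun x => ?_)
  · rw [lintegral_const_mul _ hh] at key
    simp_rw [lintegral_const_mul _ (hf _)] at key
    calc ∏ t, (∫⁻ x, f t x) ^ α t = m * ∏ t, ((M t)⁻¹ * ∫⁻ x, f t x) ^ α t := by
          rw [hm, ← prod_const_mul_rpow α hα]
          simp_rw [hcancel]
      _ ≤ m * (m⁻¹ * ∫⁻ x, h x) := by gcongr
      _ = ∫⁻ x, h x := by rw [← mul_assoc, ENNReal.mul_inv_cancel hm0 hmt, one_mul]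
  · rw [← ENNReal.mul_iSup]
    exact ENNReal.inv_mul_cancel (h0 t) (hsup t)
  · calc ∏ t, ((M t)⁻¹ * f t (x t)) ^ α t
        = m⁻¹ * (m * ∏ t, ((M t)⁻¹ * f t (x t)) ^ α t) := by
          rw [← mul_assoc, ENNReal.inv_mul_cancel hm0 hmt, one_mul]
      _ = m⁻¹ * ∏ t, f t (x t) ^ α t := by
          rw [hm, ← prod_const_mul_rpow α hα]
          simp_rw [hcancel]
      _ ≤ _ := by gcongr; exact hfh x

/-- The Prékopa–Leindler inequality on the line. -/
theorem hasPrekopaLeindler_real (α : τ → ℝ) (hα : ∀ t, 0 < α t) (hα1 : ∑ t, α t = 1) :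
    HasPrekopaLeindler α (volume : Measure ℝ) := by
  intro f h hf hh hfh
  by_cases h0 : ∃ t, ∫⁻ x, f t x = 0
  · obtain ⟨t, ht⟩ := h0
    rw [Finset.prod_eq_zero (Finset.mem_univ t)]
    · exact zero_le
    · simp [ht, hα t]
  push Not at h0
  -- Truncation at height `n` makes the suprema finite, and monotone convergence removes it.
  have hlim : ∀ t, Filter.Tendsto (fun n : ℕ => ∫⁻ x, min (f t x) n) Filter.atTop
      (nhds (∫⁻ x, f t x)) := by
    intro t
    refine lintegral_tendsto_of_tendsto_of_monotone
      (fun n => ((hf t).min measurable_const).aemeasurable) ?_ ?_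
    · refine Filter.Eventually.of_forall fun x m n hmn => ?_
      exact min_le_min le_rfl (by exact_mod_cast hmn)
    · refine Filter.Eventually.of_forall fun x => ?_
      have h1 := (tendsto_const_nhds (x := f t x)).min ENNReal.tendsto_nat_nhds_top
      simpa using h1
  have hlim' := tendsto_finsetProd_of_ne_zero Finset.univ
    (fun t n => (∫⁻ x, min (f t x) (n : ℕ)) ^ α t) (fun t => (∫⁻ x, f t x) ^ α t)
    (fun t => (hlim t).ennrpow_const (α t)) (fun t => by
      simp [ENNReal.rpow_eq_zero_iff, h0 t, (hα t).not_gt])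
  refine le_of_tendsto' hlim' fun n => ?_
  refine prekopaLeindler_of_iSup_ne_top α hα hα1 _ h
    (fun t => (hf t).min measurable_const) hh (fun t => ?_) fun x => ?_
  · exact ne_top_of_le_ne_top (ENNReal.natCast_ne_top n) (iSup_le fun x => min_le_right _ _)
  · exact (Finset.prod_le_prod' fun t _ =>
      ENNReal.rpow_le_rpow (min_le_left _ _) (hα t).le).trans (hfh x)

/-- Tensorisation: the inequality for `ν` on the fibres is exactly the hypothesis of the inequality
for `μ` on the marginals. -/
theorem HasPrekopaLeindler.prod {E F : Type*} [AddCommGroup E] [Module ℝ E] [MeasurableSpace E]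
    [AddCommGroup F] [Module ℝ F] [MeasurableSpace F] {α : τ → ℝ} {μ : Measure E} {ν : Measure F}
    [SFinite ν] (hμ : HasPrekopaLeindler α μ) (hν : HasPrekopaLeindler α ν) :
    HasPrekopaLeindler α (μ.prod ν) := by
  intro f h hf hh hfh
  simp_rw [lintegral_prod _ (hf _).aemeasurable, lintegral_prod _ hh.aemeasurable]
  refine hμ _ _ (fun t => (hf t).lintegral_prod_right') hh.lintegral_prod_right' fun x => ?_
  refine hν _ _ (fun t => (hf t).comp measurable_prodMk_left) (hh.comp measurable_prodMk_left)
    fun y => ?_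
  simpa [Prod.fst_sum, Prod.snd_sum, Prod.ext_iff] using! (hfh fun t => (x t, y t)).trans
    (le_of_eq (congrArg h (Prod.ext (by simp [Prod.fst_sum]) (by simp [Prod.snd_sum]))))

theorem HasPrekopaLeindler.of_measurePreserving {E F : Type*} [AddCommGroup E] [Module ℝ E]
    [MeasurableSpace E] [AddCommGroup F] [Module ℝ F] [MeasurableSpace F] {α : τ → ℝ}
    {μ : Measure E} {ν : Measure F} (hμ : HasPrekopaLeindler α μ) (e : E →ₗ[ℝ] F)
    (he : MeasurePreserving e μ ν) : HasPrekopaLeindler α ν := by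
  intro f h hf hh hfh
  simp_rw [← he.lintegral_comp (hf _), ← he.lintegral_comp hh]
  refine hμ _ _ (fun t => (hf t).comp he.measurable) (hh.comp he.measurable) fun x => ?_
  simpa using hfh fun t => e (x t)

theorem hasPrekopaLeindler_pi_fin (α : τ → ℝ) (hα : ∀ t, 0 < α t) (hα1 : ∑ t, α t = 1) (n : ℕ) :
    HasPrekopaLeindler α (volume : Measure (Fin n → ℝ)) := by
  induction n with
  | zero =>
    intro f h hf hh hfh
    simp_rw [Measure.volume_pi_eq_dirac (0 : Fin 0 → ℝ), lintegral_dirac' _ (hf _),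
      lintegral_dirac' _ hh]
    simpa using hfh 0
  | succ n ih =>
    let e : (ℝ × (Fin n → ℝ)) →ₗ[ℝ] (Fin (n + 1) → ℝ) :=
      { toFun := fun x => Fin.cons x.1 x.2
        map_add' := fun x y => by
          funext i
          refine Fin.cases ?_ (fun i => ?_) i <;> simp
        map_smul' := fun c x => by
          funext i
          refine Fin.cases ?_ (fun i => ?_) i <;> simp }
    refine ((hasPrekopaLeindler_real α hα hα1).prod ih).of_measurePreserving e ?_
    have := (volume_preserving_piFinSuccAbove (fun _ : Fin (n + 1) => ℝ) 0).symm
    have he : ⇑e = ⇑(MeasurableEquiv.piFinSuccAbove (fun _ : Fin (n + 1) => ℝ) 0).symm := by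
      funext x
      simp [e, MeasurableEquiv.piFinSuccAbove, Fin.insertNthEquiv]
    rw [he]
    exact this

/-- The Prékopa–Leindler inequality on `ℝ ^ ι`. -/
theorem hasPrekopaLeindler_pi {ι : Type*} [Fintype ι] (α : τ → ℝ) (hα : ∀ t, 0 < α t)
    (hα1 : ∑ t, α t = 1) : HasPrekopaLeindler α (volume : Measure (ι → ℝ)) := by
  let e : (Fin (Fintype.card ι) → ℝ) →ₗ[ℝ] (ι → ℝ) :=
    LinearMap.funLeft ℝ ℝ (Fintype.equivFin ι)
  refine (hasPrekopaLeindler_pi_fin α hα hα1 _).of_measurePreserving e ?_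
  have := volume_measurePreserving_piCongrLeft (fun _ : ι => ℝ) (Fintype.equivFin ι).symm
  convert this using 1
  funext x i
  obtain ⟨j, rfl⟩ := (Fintype.equivFin ι).symm.surjective i
  simp [e, LinearMap.funLeft, MeasurableEquiv.piCongrLeft, Equiv.piCongrLeft_apply_apply]

end BoundedTables

namespace BoundedTables
open MeasureTheory

/-! ### Tables supported on the edges of a bipartite graph

An edge `q : ι` joins the node `ℓ q : σ` to the node `κ q : ρ`. -/

variable {ι σ ρ : Type*} [Fintype ι] [DecidableEq σ] [DecidableEq ρ]

/-- The functions on `ι` whose sums over the fibers of `κ` are given by `k`. -/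
def fiberTables (κ : ι → ρ) (k : ρ → ℕ) : Set (ι → ℕ) :=
  {a | ∀ c, ∑ q with κ q = c, a q = k c}

theorem le_of_mem_fiberTables {κ : ι → ρ} {k : ρ → ℕ} {a : ι → ℕ} (ha : a ∈ fiberTables κ k)
    (q : ι) : a q ≤ k (κ q) := by
  rw [← ha (κ q)]
  exact Finset.single_le_sum (f := a) (fun _ _ => Nat.zero_le _) (by simp)

theorem fiberTables_finite (κ : ι → ρ) (k : ρ → ℕ) : (fiberTables κ k).Finite :=
  (Set.Finite.pi' fun q => Set.finite_Iic (k (κ q))).subset fun _ ha q =>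
    le_of_mem_fiberTables ha q

/-- The tables on the edges with margins `β` and `k`. -/
noncomputable def edgeTables (ℓ : ι → σ) (κ : ι → ρ) (β : σ → ℕ) (k : ρ → ℕ) :
    Finset (ι → ℕ) :=
  ((fiberTables_finite ℓ β).inter_of_left (fiberTables κ k)).toFinset

theorem mem_edgeTables {ℓ : ι → σ} {κ : ι → ρ} {β : σ → ℕ} {k : ρ → ℕ} {a : ι → ℕ} :
    a ∈ edgeTables ℓ κ β k ↔ a ∈ fiberTables ℓ β ∧ a ∈ fiberTables κ k := by
  simp [edgeTables]

theorem edgeTables_swap (ℓ : ι → σ) (κ : ι → ρ) (β : σ → ℕ) (k : ρ → ℕ) :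
    edgeTables κ ℓ k β = edgeTables ℓ κ β k := by
  ext a
  rw [mem_edgeTables, mem_edgeTables, and_comm]

/-- The generating function of the tables with margins `β` and `k`. -/
noncomputable def tableSum (ℓ : ι → σ) (κ : ι → ρ) (β : σ → ℕ) (k : ρ → ℕ) (x : ι → ℝ) : ℝ :=
  ∑ a ∈ edgeTables ℓ κ β k, ∏ q, x q ^ a q / ((a q).factorial : ℝ)

theorem tableSum_nonneg (ℓ : ι → σ) (κ : ι → ρ) (β : σ → ℕ) (k : ρ → ℕ) {x : ι → ℝ}
    (hx : ∀ q, 0 ≤ x q) : 0 ≤ tableSum ℓ κ β k x :=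
  Finset.sum_nonneg fun a _ => Finset.prod_nonneg fun q _ =>
    div_nonneg (pow_nonneg (hx q) _) (by positivity)

/-! ### Upper and lower capacity bounds for the generating function -/

variable [Fintype σ] [Fintype ρ]

theorem prod_fiber {M : Type*} [CommMonoid M] (κ : ι → ρ) (w : ι → M) :
    ∏ c, ∏ q with κ q = c, w q = ∏ q, w q :=
  Finset.prod_fiberwise Finset.univ κ w

/-- Expansion of a product of powers of sums over the fibers of `κ`. -/
theorem prod_sum_fiber_pow {S : Type*} [CommSemiring S] (κ : ι → ρ) (k : ρ → ℕ) (w : ι → S) :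
    ∏ c, (∑ q with κ q = c, w q) ^ k c = ∑ a ∈ (fiberTables_finite κ k).toFinset,
      ((∏ c, Nat.multinomial {q | κ q = c} a : ℕ) : S) * ∏ q, w q ^ a q := by
  classical
  simp_rw [Finset.sum_pow_eq_sum_piAntidiag, Finset.prod_univ_sum]
  refine Finset.sum_bij' (fun φ _ q => φ (κ q) q) (fun a _ c q => if κ q = c then a q else 0)
    ?_ ?_ ?_ ?_ ?_
  · intro φ hφ
    simp only [Fintype.mem_piFinset, Finset.mem_piAntidiag] at hφ
    rw [Set.Finite.mem_toFinset]
    intro c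
    rw [← (hφ c).1]
    exact Finset.sum_congr rfl fun q hq => by rw [← (Finset.mem_filter.mp hq).2]
  · intro a ha
    rw [Set.Finite.mem_toFinset] at ha
    simp only [Fintype.mem_piFinset, Finset.mem_piAntidiag]
    intro c
    refine ⟨?_, fun q hq => ?_⟩
    · rw [← ha c]
      exact Finset.sum_congr rfl fun q hq => by rw [if_pos (Finset.mem_filter.mp hq).2]
    · simp only [ne_eq, ite_eq_right_iff, not_forall] at hq
      obtain ⟨hq, -⟩ := hq
      simpa using hq
  · intro φ hφ
    simp only [Fintype.mem_piFinset, Finset.mem_piAntidiag] at hφ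
    funext c q
    by_cases h : κ q = c
    · subst h; simp
    · rw [if_neg h]
      by_contra h0
      have := (hφ c).2 q (Ne.symm h0)
      simp [h] at this
  · intro a ha
    funext q
    simp
  · intro φ hφ
    rw [Finset.prod_mul_distrib, Nat.cast_prod, ← prod_fiber κ]
    congr 1
    · refine Finset.prod_congr rfl fun c _ => ?_
      congr 1
      refine Nat.multinomial_congr fun q hq => ?_
      rw [(Finset.mem_filter.mp hq).2]
    · refine Finset.prod_congr rfl fun c _ => Finset.prod_congr rfl fun q hq => ?_
      rw [← (Finset.mem_filter.mp hq).2]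

theorem prod_multinomial_eq {κ : ι → ρ} {k : ρ → ℕ} {a : ι → ℕ} (ha : a ∈ fiberTables κ k) :
    ((∏ c, Nat.multinomial {q | κ q = c} a : ℕ) : ℝ) =
      (∏ c, ((k c).factorial : ℝ)) * ∏ q, ((a q).factorial : ℝ)⁻¹ := by
  rw [Finset.prod_inv_distrib, eq_mul_inv_iff_mul_eq₀
    (Finset.prod_ne_zero_iff.mpr fun q _ => by positivity), ← prod_fiber κ]
  rw [Nat.cast_prod, ← Finset.prod_mul_distrib]
  refine Finset.prod_congr rfl fun c _ => ?_
  rw [← ha c, ← Nat.multinomial_spec, Nat.cast_mul, Nat.cast_prod, mul_comm]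

theorem vecOmega_pos {ι : Type*} [Fintype ι] (v : ι → ℕ) : 0 < vecOmega v :=
  Finset.prod_pos fun i _ => omega_pos (v i)

theorem prod_pow_eq_of_mem_fiberTables {κ : ι → ρ} {k : ρ → ℕ} {a : ι → ℕ}
    (ha : a ∈ fiberTables κ k) (u : ρ → ℝ) : ∏ c, u c ^ k c = ∏ q, u (κ q) ^ a q := by
  rw [← prod_fiber κ]
  refine Finset.prod_congr rfl fun c _ => ?_
  rw [← ha c, ← Finset.prod_pow_eq_pow_sum]
  exact Finset.prod_congr rfl fun q hq => by rw [(Finset.mem_filter.mp hq).2]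

/-- Up to factorials, the left-hand sum consists of the terms of the expansion of `∏ W_c ^ k_c` that
have the other margin `β`; the remaining terms are nonnegative. AM-GM then replaces this product by
a power of `∑ W_c`. -/
theorem tableSum_mul_le (ℓ : ι → σ) (κ : ι → ρ) (β : σ → ℕ) (k : ρ → ℕ) {x : ι → ℝ}
    (hx : ∀ q, 0 ≤ x q) {y : σ → ℝ} (hy : ∀ s, 0 ≤ y s) {v : ρ → ℝ} (hv : ∀ c, 0 ≤ v c) :
    tableSum ℓ κ β k x * ((∏ s, y s ^ β s) * ∏ c, v c ^ k c) *
        ((∑ c, k c : ℕ) : ℝ) ^ (∑ c, k c) ≤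
      vecOmega k * (∑ q, x q * y (ℓ q) * v (κ q)) ^ (∑ c, k c) := by
  classical
  set w : ι → ℝ := fun q => x q * y (ℓ q) * v (κ q) with hw
  have hw0 : ∀ q, 0 ≤ w q := fun q => mul_nonneg (mul_nonneg (hx q) (hy _)) (hv _)
  set W : ρ → ℝ := fun c => ∑ q with κ q = c, w q with hW
  have hWsum : ∑ c, W c = ∑ q, w q := Finset.sum_fiberwise Finset.univ κ w
  have hfact : 0 < ∏ c, ((k c).factorial : ℝ) := Finset.prod_pos fun c _ => by positivity
  have h1 : tableSum ℓ κ β k x * ((∏ s, y s ^ β s) * ∏ c, v c ^ k c) *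
      ∏ c, ((k c).factorial : ℝ) ≤ ∏ c, W c ^ k c := by
    rw [hW, prod_sum_fiber_pow κ k w, tableSum, Finset.sum_mul, Finset.sum_mul]
    refine le_trans (le_of_eq ?_) (Finset.sum_le_sum_of_subset_of_nonneg
      (s := edgeTables ℓ κ β k) (fun a ha => ?_) fun a _ _ => ?_)
    · refine Finset.sum_congr rfl fun a ha => ?_
      obtain ⟨ha1, ha2⟩ := mem_edgeTables.mp ha
      rw [prod_multinomial_eq ha2, prod_pow_eq_of_mem_fiberTables ha1,
        prod_pow_eq_of_mem_fiberTables ha2]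
      simp_rw [hw, mul_pow, div_eq_mul_inv, Finset.prod_mul_distrib]
      ring
    · rw [Set.Finite.mem_toFinset]
      exact (mem_edgeTables.mp ha).2
    · exact mul_nonneg (Nat.cast_nonneg _) (Finset.prod_nonneg fun q _ => pow_nonneg (hw0 q) _)
  have h2 := prod_pow_mul_sum_pow_le k W fun c => Finset.sum_nonneg fun q _ => hw0 q
  rw [hWsum] at h2
  have h3 : vecOmega k = (∏ c, (k c : ℝ) ^ k c) / ∏ c, ((k c).factorial : ℝ) := by
    rw [vecOmega, ← Finset.prod_div_distrib]
    rfl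
  rw [h3, div_mul_eq_mul_div, le_div_iff₀ hfact]
  calc _ = tableSum ℓ κ β k x * ((∏ s, y s ^ β s) * ∏ c, v c ^ k c) *
      (∏ c, ((k c).factorial : ℝ)) * ((∑ c, k c : ℕ) : ℝ) ^ (∑ c, k c) := by ring
    _ ≤ (∏ c, W c ^ k c) * ((∑ c, k c : ℕ) : ℝ) ^ (∑ c, k c) := by gcongr
    _ ≤ _ := h2

/-- The two sides of the graph play symmetric roles, so the expansion may be made over either. This
is the source of the minimum in the theorem. -/
theorem tableSum_mul_le_min (ℓ : ι → σ) (κ : ι → ρ) (β : σ → ℕ) (k : ρ → ℕ)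
    (hβ : ∑ s, β s = ∑ c, k c) {x : ι → ℝ} (hx : ∀ q, 0 ≤ x q) {y : σ → ℝ} (hy : ∀ s, 0 ≤ y s)
    {v : ρ → ℝ} (hv : ∀ c, 0 ≤ v c) :
    tableSum ℓ κ β k x * ((∏ s, y s ^ β s) * ∏ c, v c ^ k c) *
        ((∑ c, k c : ℕ) : ℝ) ^ (∑ c, k c) ≤
      min (vecOmega β) (vecOmega k) * (∑ q, x q * y (ℓ q) * v (κ q)) ^ (∑ c, k c) := by
  rw [min_mul_of_nonneg _ _ (pow_nonneg (Finset.sum_nonneg fun q _ =>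
    mul_nonneg (mul_nonneg (hx q) (hy _)) (hv _)) _)]
  refine le_min ?_ (tableSum_mul_le ℓ κ β k hx hy hv)
  have h := tableSum_mul_le κ ℓ k β hx hv hy
  rw [tableSum, edgeTables_swap, hβ, mul_comm (∏ c, v c ^ k c)] at h
  simpa only [tableSum, mul_right_comm] using h

/-- The capacity bound for the generating function of tables. -/
theorem le_tableSum (ℓ : ι → σ) (κ : ι → ρ) (β : σ → ℕ) (k : ρ → ℕ)
    (hβ : ∑ s, β s = ∑ c, k c) {x : ι → ℝ} (hx : ∀ q, 0 ≤ x q) {b : ℝ} (hb : 0 < b)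
    (h : ∀ y : σ → ℝ, (∀ s, 0 < y s) →
      b * ∏ s, y s ^ β s ≤ ∏ c, (∑ q with κ q = c, x q * y (ℓ q)) ^ k c) :
    b * (vecOmega β / omega (∑ c, k c)) ≤
      (∏ c, ((k c).factorial : ℝ)) * tableSum ℓ κ β k x := by
  classical
  -- Parallel edges between `c` and `s` are merged into one coefficient of the linear form of `c`.
  set A : ρ → σ → ℝ := fun c s => ∑ q with κ q = c, if ℓ q = s then x q else 0 with hA
  have hA0 : ∀ c s, 0 ≤ A c s := fun c s => Finset.sum_nonneg fun q _ => by
    split_ifs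
    exacts [hx q, le_rfl]
  set β' : σ →₀ ℕ := Finsupp.equivFunOnFinite.symm β with hβ'
  have hsum : ∀ (y : σ → ℝ) c, ∑ s, A c s * y s = ∑ q with κ q = c, x q * y (ℓ q) := by
    intro y c
    simp_rw [hA, Finset.sum_mul]
    rw [Finset.sum_comm]
    refine Finset.sum_congr rfl fun q _ => ?_
    simp [ite_mul]
  have key := le_coeff_prod_linear_pow A hA0 k β' hβ hb (fun y hy => by
    simp_rw [hsum]
    exact h y hy)
  refine key.trans (le_of_eq ?_)
  have hpoly : ∀ c, ∑ s, MvPolynomial.C (A c s) * MvPolynomial.X s =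
      ∑ q with κ q = c, (MvPolynomial.monomial (Finsupp.single (ℓ q) 1) (x q)) := by
    intro c
    simp_rw [hA, map_sum, Finset.sum_mul]
    rw [Finset.sum_comm]
    refine Finset.sum_congr rfl fun q _ => ?_
    rw [Finset.sum_eq_single (ℓ q)]
    · rw [if_pos rfl, MvPolynomial.C_mul_X_eq_monomial]
    · intro s _ hs
      rw [if_neg hs.symm, map_zero, zero_mul]
    · simp
  simp_rw [hpoly]
  rw [prod_sum_fiber_pow, MvPolynomial.coeff_sum, tableSum, Finset.mul_sum]
  have hmon : ∀ a : ι → ℕ, ∏ q, (MvPolynomial.monomial (Finsupp.single (ℓ q) 1) (x q)) ^ a q =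
      MvPolynomial.monomial (∑ q, Finsupp.single (ℓ q) (a q)) (∏ q, x q ^ a q) := by
    intro a
    rw [MvPolynomial.monomial_sum_prod]
    refine Finset.prod_congr rfl fun q _ => ?_
    rw [MvPolynomial.monomial_pow, Finsupp.smul_single, smul_eq_mul, mul_one]
  have hdeg : ∀ a : ι → ℕ, ∑ q, Finsupp.single (ℓ q) (a q) = β' ↔ a ∈ fiberTables ℓ β := by
    intro a
    rw [DFunLike.ext_iff]
    refine forall_congr' fun s => ?_
    rw [Finsupp.finsetSum_apply, Finset.sum_filter]
    simp [hβ', Finsupp.single_apply]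
  have hcoeff : ∀ a : ι → ℕ, MvPolynomial.coeff β'
      (((∏ c, Nat.multinomial {q | κ q = c} a : ℕ) : MvPolynomial σ ℝ) *
        ∏ q, (MvPolynomial.monomial (Finsupp.single (ℓ q) 1) (x q)) ^ a q) =
      if a ∈ fiberTables ℓ β then
        ((∏ c, Nat.multinomial {q | κ q = c} a : ℕ) : ℝ) * ∏ q, x q ^ a q else 0 := by
    intro a
    rw [hmon, ← map_natCast (MvPolynomial.C : ℝ →+* MvPolynomial σ ℝ), MvPolynomial.coeff_C_mul,
      MvPolynomial.coeff_monomial, mul_ite, mul_zero]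
    simp only [hdeg]
  simp_rw [hcoeff]
  rw [← Finset.sum_filter]
  refine Finset.sum_congr ?_ fun a ha => ?_
  · ext a
    rw [Finset.mem_filter, Set.Finite.mem_toFinset, mem_edgeTables, and_comm]
  · rw [prod_multinomial_eq (mem_edgeTables.mp ha).2, mul_assoc, ← Finset.prod_mul_distrib]
    congr 1
    refine Finset.prod_congr rfl fun q _ => ?_
    rw [div_eq_mul_inv, mul_comm]

end BoundedTables

namespace BoundedTables
open MeasureTheory

variable {ι σ ρ τ : Type*} [Fintype ι] [DecidableEq σ] [DecidableEq ρ]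

/-! ### The number of tables as an integral -/

/-- The density of the gamma distribution with parameter `a + 1`. -/
noncomputable def expWeight (a : ℕ) : ℝ → ℝ :=
  (Set.Ioi 0).indicator fun r => r ^ a / (a.factorial : ℝ) * Real.exp (-r)

theorem expWeight_nonneg (a : ℕ) (r : ℝ) : 0 ≤ expWeight a r :=
  Set.indicator_nonneg (fun r (hr : 0 < r) => by positivity) r

theorem measurable_expWeight (a : ℕ) : Measurable (expWeight a) :=
  Measurable.indicator (by fun_prop) measurableSet_Ioi

theorem integrable_expWeight (a : ℕ) : Integrable (expWeight a) := by
  rw [expWeight, integrable_indicator_iff measurableSet_Ioi]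
  have h := (Real.GammaIntegral_convergent (s := a + 1) (by positivity)).div_const
    (a.factorial : ℝ)
  refine IntegrableOn.congr_fun h (fun r _ => ?_) measurableSet_Ioi
  simp only [add_sub_cancel_right, Real.rpow_natCast]
  ring

theorem integral_expWeight (a : ℕ) : ∫ r, expWeight a r = 1 := by
  rw [expWeight, integral_indicator measurableSet_Ioi]
  have h := Real.Gamma_eq_integral (s := a + 1) (by positivity)
  rw [Real.Gamma_nat_eq_factorial] at h
  have h' : ∫ r in Set.Ioi (0 : ℝ), r ^ a / (a.factorial : ℝ) * Real.exp (-r) =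
      (∫ r in Set.Ioi (0 : ℝ), Real.exp (-r) * r ^ ((a : ℝ) + 1 - 1)) / (a.factorial : ℝ) := by
    rw [← integral_div]
    refine integral_congr_ae (Filter.Eventually.of_forall fun r => ?_)
    simp only [add_sub_cancel_right, Real.rpow_natCast]
    ring
  rw [h', ← h]
  exact div_self (by positivity)

theorem sum_prod_expWeight_of_pos (ℓ : ι → σ) (κ : ι → ρ) (β : σ → ℕ) (k : ρ → ℕ) {x : ι → ℝ}
    (hx : ∀ q, 0 < x q) : ∑ a ∈ edgeTables ℓ κ β k, ∏ q, expWeight (a q) (x q) =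
      tableSum ℓ κ β k x * Real.exp (-∑ q, x q) := by
  rw [tableSum, Finset.sum_mul]
  refine Finset.sum_congr rfl fun a _ => ?_
  rw [← Finset.sum_neg_distrib, Real.exp_sum, ← Finset.prod_mul_distrib]
  refine Finset.prod_congr rfl fun q _ => ?_
  rw [expWeight, Set.indicator_of_mem (Set.mem_Ioi.mpr (hx q))]

theorem sum_prod_expWeight_of_nonpos (s : Finset (ι → ℕ)) {x : ι → ℝ} {q : ι} (hq : x q ≤ 0) :
    ∑ a ∈ s, ∏ q, expWeight (a q) (x q) = 0 :=
  Finset.sum_eq_zero fun a _ => Finset.prod_eq_zero (Finset.mem_univ q)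
    (Set.indicator_of_notMem (by simpa using hq) _)

theorem lintegral_sum_prod_expWeight (s : Finset (ι → ℕ)) {r : ℝ} (hr : 0 ≤ r) :
    ∫⁻ x : ι → ℝ, ENNReal.ofReal (r * ∑ a ∈ s, ∏ q, expWeight (a q) (x q)) =
      ENNReal.ofReal (r * s.card) := by
  have hint : ∀ a ∈ s, Integrable fun x : ι → ℝ => ∏ q, expWeight (a q) (x q) := fun a _ =>
    Integrable.fintype_prod fun q => integrable_expWeight (a q)
  rw [← ofReal_integral_eq_lintegral_ofReal ((integrable_finsetSum s hint).const_mul r)]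
  · rw [integral_const_mul, integral_finsetSum s hint]
    simp_rw [fun a : ι → ℕ => integral_fintype_prod_volume_eq_prod fun q => expWeight (a q),
      integral_expWeight]
    simp
  · exact Filter.Eventually.of_forall fun x => mul_nonneg hr (Finset.sum_nonneg fun a _ =>
      Finset.prod_nonneg fun q _ => expWeight_nonneg _ _)

/-! ### From pointwise log-concavity to the count of tables -/

variable [Fintype σ] [Fintype ρ]

/-- Log-concavity, up to the factors `Ω`, of the generating functions of tables, jointly in the
margin and in the point. -/
theorem prod_tableSum_rpow_le [Fintype τ] (ℓ : ι → σ) {κ : ι → ρ} (hκ : Function.Surjective κ)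
    {α : τ → ℝ} (hα : ∀ t, 0 < α t) (hα1 : ∑ t, α t = 1) (k : ρ → ℕ) (b : τ → σ → ℕ)
    (hb : ∀ t, ∑ s, b t s = ∑ c, k c) (β : σ → ℕ) (hβ : ∀ s, (β s : ℝ) = ∑ t, α t * b t s)
    {x : τ → ι → ℝ} (hx : ∀ t q, 0 < x t q) :
    ∏ t, (tableSum ℓ κ (b t) k (x t) / min (vecOmega (b t)) (vecOmega k)) ^ α t ≤
      omega (∑ c, k c) * tableSum ℓ κ β k (∑ t, α t • x t) / (vecOmega β * vecOmega k) := by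
  set D := ∑ c, k c with hD
  have hβsum : ∑ s, β s = D := by
    have h : ((∑ s, β s : ℕ) : ℝ) = D := by
      push_cast
      simp_rw [hβ]
      rw [Finset.sum_comm]
      simp_rw [← Finset.mul_sum, ← Nat.cast_sum, hb]
      rw [← Finset.sum_mul, hα1, one_mul]
    exact_mod_cast h
  set z : ι → ℝ := ∑ t, α t • x t with hz
  have hzq : ∀ q, z q = ∑ t, α t * x t q := fun q => by simp [hz, Finset.sum_apply]
  have hτ : (Finset.univ : Finset τ).Nonempty := by
    by_contra h
    rw [Finset.not_nonempty_iff_eq_empty] at h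
    simp [h] at hα1
  have hz0 : ∀ q, 0 < z q := fun q => by
    rw [hzq]
    exact Finset.sum_pos (fun t _ => mul_pos (hα t) (hx t q)) hτ
  set M : τ → ℝ := fun t => min (vecOmega (b t)) (vecOmega k) with hM
  have hM0 : ∀ t, 0 < M t := fun t => lt_min (vecOmega_pos _) (vecOmega_pos _)
  set F : τ → ℝ := fun t => tableSum ℓ κ (b t) k (x t) / M t with hF
  have hF0 : ∀ t, 0 ≤ F t := fun t =>
    div_nonneg (tableSum_nonneg ℓ κ _ k fun q => (hx t q).le) (hM0 t).le
  set c := ∏ t, F t ^ α t with hc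
  have hc0 : 0 ≤ c := Finset.prod_nonneg fun t _ => Real.rpow_nonneg (hF0 t) _
  have hrpow : ∀ r : ℝ, 0 ≤ r → ∏ t, r ^ α t = r := fun r hr => by
    rw [← Real.rpow_sum_of_nonneg hr fun t _ => (hα t).le, hα1, Real.rpow_one]
  have hDD : (0 : ℝ) < (D : ℝ) ^ D := by
    rcases Nat.eq_zero_or_pos D with h | h
    · simp [h]
    · positivity
  -- Weighted geometric mean of the upper bounds: the exponents of `y` average to `β`, and AM-GM
  -- merges the forms `L t`, linear in `x t`, into the form at `z`.
  have hupper : ∀ (y : σ → ℝ) (v : ρ → ℝ), (∀ s, 0 < y s) → (∀ c, 0 ≤ v c) →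
      c * ((∏ s, y s ^ β s) * ∏ c, v c ^ k c) * (D : ℝ) ^ D ≤
        (∑ q, z q * y (ℓ q) * v (κ q)) ^ D := by
    intro y v hy hv
    set L : τ → ℝ := fun t => ∑ q, x t q * y (ℓ q) * v (κ q) with hL
    have hL0 : ∀ t, 0 ≤ L t := fun t => Finset.sum_nonneg fun q _ =>
      mul_nonneg (mul_nonneg (hx t q).le (hy _).le) (hv _)
    have hY0 : ∀ t, 0 ≤ ∏ s, y s ^ b t s := fun t =>
      Finset.prod_nonneg fun s _ => pow_nonneg (hy s).le _
    have hV0 : 0 ≤ ∏ c, v c ^ k c := Finset.prod_nonneg fun c _ => pow_nonneg (hv c) _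
    have h1 : ∀ t, F t * ((∏ s, y s ^ b t s) * ∏ c, v c ^ k c) * (D : ℝ) ^ D ≤ L t ^ D := by
      intro t
      have h := tableSum_mul_le_min ℓ κ (b t) k (hb t) (fun q => (hx t q).le)
        (fun s => (hy s).le) hv
      rw [hF]
      simp only
      rw [div_mul_eq_mul_div, div_mul_eq_mul_div, div_le_iff₀ (hM0 t), mul_comm (L t ^ D)]
      exact h
    have h2 : ∏ t, (F t * ((∏ s, y s ^ b t s) * ∏ c, v c ^ k c) * (D : ℝ) ^ D) ^ α t ≤
        ∏ t, (L t ^ D) ^ α t :=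
      Finset.prod_le_prod (fun t _ => Real.rpow_nonneg (mul_nonneg (mul_nonneg (hF0 t)
        (mul_nonneg (hY0 t) hV0)) hDD.le) _) fun t _ => Real.rpow_le_rpow
          (mul_nonneg (mul_nonneg (hF0 t) (mul_nonneg (hY0 t) hV0)) hDD.le) (h1 t) (hα t).le
    have h3 : ∏ t, (∏ s, y s ^ b t s) ^ α t = ∏ s, y s ^ β s := by
      have : ∀ t, (∏ s, y s ^ b t s) ^ α t = ∏ s, y s ^ (α t * b t s) := fun t => by
        rw [← Real.finsetProd_rpow _ _ fun s _ => pow_nonneg (hy s).le _]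
        refine Finset.prod_congr rfl fun s _ => ?_
        rw [mul_comm, Real.rpow_mul (hy s).le, Real.rpow_natCast]
      simp_rw [this]
      rw [Finset.prod_comm]
      refine Finset.prod_congr rfl fun s _ => ?_
      rw [← Real.rpow_sum_of_pos (hy s), ← hβ, Real.rpow_natCast]
    have h4 : ∏ t, (F t * ((∏ s, y s ^ b t s) * ∏ c, v c ^ k c) * (D : ℝ) ^ D) ^ α t =
        c * ((∏ s, y s ^ β s) * ∏ c, v c ^ k c) * (D : ℝ) ^ D := by
      have : ∀ t, (F t * ((∏ s, y s ^ b t s) * ∏ c, v c ^ k c) * (D : ℝ) ^ D) ^ α t =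
          F t ^ α t * ((∏ s, y s ^ b t s) ^ α t * (∏ c, v c ^ k c) ^ α t) *
            ((D : ℝ) ^ D) ^ α t := fun t => by
        rw [Real.mul_rpow (mul_nonneg (hF0 t) (mul_nonneg (hY0 t) hV0)) hDD.le,
          Real.mul_rpow (hF0 t) (mul_nonneg (hY0 t) hV0), Real.mul_rpow (hY0 t) hV0]
      simp_rw [this, Finset.prod_mul_distrib]
      rw [h3, hrpow _ hV0, hrpow _ hDD.le]
    have h5 : ∏ t, (L t ^ D) ^ α t = (∏ t, L t ^ α t) ^ D := by
      rw [← Finset.prod_pow]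
      refine Finset.prod_congr rfl fun t _ => ?_
      rw [← Real.rpow_natCast, ← Real.rpow_mul (hL0 t), mul_comm, Real.rpow_mul (hL0 t),
        Real.rpow_natCast]
    have h6 : ∏ t, L t ^ α t ≤ ∑ t, α t * L t :=
      Real.geom_mean_le_arith_mean_weighted Finset.univ α L (fun t _ => (hα t).le) hα1
        fun t _ => hL0 t
    have h7 : ∑ t, α t * L t = ∑ q, z q * y (ℓ q) * v (κ q) := by
      simp_rw [hL, Finset.mul_sum, hzq, Finset.sum_mul]
      rw [Finset.sum_comm]
      simp_rw [mul_assoc]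
    rw [h4, h5] at h2
    rw [← h7]
    exact h2.trans (pow_le_pow_left₀
      (Finset.prod_nonneg fun t _ => Real.rpow_nonneg (hL0 t) _) h6 _)
  rcases hc0.eq_or_lt with h0 | hcpos
  -- The capacity bound needs a positive constant, so `c = 0` is treated apart.
  · rw [← h0]
    exact div_nonneg (mul_nonneg (omega_pos _).le (tableSum_nonneg ℓ κ _ k fun q => (hz0 q).le))
      (mul_pos (vecOmega_pos _) (vecOmega_pos _)).le
  have hkk : 0 < ∏ c, (k c : ℝ) ^ k c := Finset.prod_pos fun c _ => by
    rcases Nat.eq_zero_or_pos (k c) with h | h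
    · simp [h]
    · positivity
  have hlow := le_tableSum ℓ κ β k hβsum (fun q => (hz0 q).le) (b := c * ∏ c, (k c : ℝ) ^ k c)
    (mul_pos hcpos hkk) ?_
  · have hfact : 0 < ∏ c, ((k c).factorial : ℝ) := Finset.prod_pos fun c _ => by positivity
    have hΩ : vecOmega k * ∏ c, ((k c).factorial : ℝ) = ∏ c, (k c : ℝ) ^ k c := by
      rw [vecOmega, ← Finset.prod_mul_distrib]
      refine Finset.prod_congr rfl fun c _ => ?_
      exact div_mul_cancel₀ _ (by positivity)
    rw [← hΩ, ← hD, mul_div_assoc', div_le_iff₀ (omega_pos D)] at hlow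
    rw [le_div_iff₀ (mul_pos (vecOmega_pos _) (vecOmega_pos _)),
      ← mul_le_mul_iff_left₀ hfact]
    calc _ = c * (vecOmega k * ∏ c, ((k c).factorial : ℝ)) * vecOmega β := by ring
      _ ≤ _ := hlow
      _ = _ := by ring
  · intro y hy
    set g : ρ → ℝ := fun c => ∑ q with κ q = c, z q * y (ℓ q) with hg
    -- Surjectivity of `κ` enters here: a node without edges would give `g c = 0`.
    have hg0 : ∀ c, 0 < g c := fun c => by
      obtain ⟨q, hq⟩ := hκ c
      exact Finset.sum_pos (fun q _ => mul_pos (hz0 q) (hy _)) ⟨q, by simpa using hq⟩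
    -- This `v` is the equality case of AM-GM: each node `c` contributes exactly `k c` to the form,
    -- whose value is then `D`, and the powers `D ^ D` cancel.
    have h := hupper y (fun c => k c / g c) hy fun c => div_nonneg (Nat.cast_nonneg _) (hg0 c).le
    have hsum : ∑ q, z q * y (ℓ q) * (k (κ q) / g (κ q)) = D := by
      rw [← Finset.sum_fiberwise Finset.univ κ, hD]
      push_cast
      refine Finset.sum_congr rfl fun c _ => ?_
      have : ∀ q ∈ Finset.univ.filter (κ · = c), z q * y (ℓ q) * (k (κ q) / g (κ q)) =
          z q * y (ℓ q) * (k c / g c) := fun q hq => by rw [(Finset.mem_filter.mp hq).2]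
      rw [Finset.sum_congr rfl this, ← Finset.sum_mul]
      exact mul_div_cancel₀ _ (hg0 c).ne'
    rw [hsum] at h
    have h' := le_of_mul_le_mul_right (h.trans (one_mul _).ge) hDD
    simp_rw [div_pow] at h'
    rw [Finset.prod_div_distrib, mul_div_assoc', mul_div_assoc', div_le_one
      (Finset.prod_pos fun c _ => pow_pos (hg0 c) _)] at h'
    calc _ = c * ((∏ s, y s ^ β s) * ∏ c, (k c : ℝ) ^ k c) := by ring
      _ ≤ _ := h'

/-- Each count is the integral of its generating function against `exp (-∑ x_q)`. Prékopa–Leindler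
integrates the pointwise inequality, since the weighted product of these exponentials is the
exponential at the averaged point. -/
theorem prod_card_edgeTables_rpow_le_of_pos [Fintype τ] (ℓ : ι → σ) {κ : ι → ρ}
    (hκ : Function.Surjective κ) {α : τ → ℝ} (hα : ∀ t, 0 < α t) (hα1 : ∑ t, α t = 1)
    (k : ρ → ℕ) (b : τ → σ → ℕ) (hb : ∀ t, ∑ s, b t s = ∑ c, k c) (β : σ → ℕ)
    (hβ : ∀ s, (β s : ℝ) = ∑ t, α t * b t s) :
    ∏ t, (((edgeTables ℓ κ (b t) k).card : ℝ) / min (vecOmega (b t)) (vecOmega k)) ^ α t ≤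
      omega (∑ c, k c) * (edgeTables ℓ κ β k).card / (vecOmega β * vecOmega k) := by
  set M : τ → ℝ := fun t => min (vecOmega (b t)) (vecOmega k) with hM
  have hM0 : ∀ t, 0 < M t := fun t => lt_min (vecOmega_pos _) (vecOmega_pos _)
  set B : ℝ := omega (∑ c, k c) / (vecOmega β * vecOmega k) with hB
  have hB0 : 0 < B := div_pos (omega_pos _) (mul_pos (vecOmega_pos _) (vecOmega_pos _))
  have hmeas : ∀ (r : ℝ) (s : Finset (ι → ℕ)), Measurable fun x : ι → ℝ =>
      ENNReal.ofReal (r * ∑ a ∈ s, ∏ q, expWeight (a q) (x q)) := fun r s =>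
    ((Finset.measurable_fun_sum s fun a _ => Finset.measurable_fun_prod _ fun q _ =>
      (measurable_expWeight (a q)).comp (measurable_pi_apply q)).const_mul r).ennreal_ofReal
  have key := hasPrekopaLeindler_pi (ι := ι) α hα hα1
    (fun t x => ENNReal.ofReal ((M t)⁻¹ * ∑ a ∈ edgeTables ℓ κ (b t) k,
      ∏ q, expWeight (a q) (x q)))
    (fun x => ENNReal.ofReal (B * ∑ a ∈ edgeTables ℓ κ β k, ∏ q, expWeight (a q) (x q)))
    (fun t => hmeas _ _) (hmeas _ _) (fun x => ?_)
  · simp_rw [lintegral_sum_prod_expWeight _ hB0.le,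
      lintegral_sum_prod_expWeight _ (inv_pos.mpr (hM0 _)).le] at key
    have hnn : ∀ t, 0 ≤ (M t)⁻¹ * ((edgeTables ℓ κ (b t) k).card : ℝ) := fun t =>
      mul_nonneg (inv_pos.mpr (hM0 t)).le (Nat.cast_nonneg _)
    simp_rw [fun t => ENNReal.ofReal_rpow_of_nonneg (hnn t) (hα t).le] at key
    rw [← ENNReal.ofReal_prod_of_nonneg fun t _ => Real.rpow_nonneg (hnn t) _,
      ENNReal.ofReal_le_ofReal_iff (mul_nonneg hB0.le (Nat.cast_nonneg _))] at key
    convert key using 1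
    · exact Finset.prod_congr rfl fun t _ => by rw [div_eq_inv_mul]
    · rw [hB]
      ring
  · by_cases hx : ∀ t q, 0 < x t q
    · have hzq : ∀ q, (∑ t, α t • x t) q = ∑ t, α t * x t q := fun q => by
        simp [Finset.sum_apply]
      have hτ : (Finset.univ : Finset τ).Nonempty := by
        by_contra h
        rw [Finset.not_nonempty_iff_eq_empty] at h
        simp [h] at hα1
      have hz0 : ∀ q, 0 < (∑ t, α t • x t) q := fun q => by
        rw [hzq]
        exact Finset.sum_pos (fun t _ => mul_pos (hα t) (hx t q)) hτ
      have hnn : ∀ t, 0 ≤ tableSum ℓ κ (b t) k (x t) / M t := fun t =>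
        div_nonneg (tableSum_nonneg ℓ κ _ k fun q => (hx t q).le) (hM0 t).le
      have hterm : ∀ t, ENNReal.ofReal ((M t)⁻¹ * ∑ a ∈ edgeTables ℓ κ (b t) k,
          ∏ q, expWeight (a q) (x t q)) ^ α t =
          ENNReal.ofReal ((tableSum ℓ κ (b t) k (x t) / M t) ^ α t *
            Real.exp (-(α t * ∑ q, x t q))) := fun t => by
        rw [sum_prod_expWeight_of_pos ℓ κ _ k (hx t), ← mul_assoc, inv_mul_eq_div,
          ENNReal.ofReal_rpow_of_nonneg (mul_nonneg (hnn t) (Real.exp_pos _).le) (hα t).le,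
          Real.mul_rpow (hnn t) (Real.exp_pos _).le, ← Real.exp_mul]
        congr 3
        ring
      simp_rw [hterm]
      rw [← ENNReal.ofReal_prod_of_nonneg fun t _ =>
        mul_nonneg (Real.rpow_nonneg (hnn t) _) (Real.exp_pos _).le]
      refine ENNReal.ofReal_le_ofReal ?_
      rw [sum_prod_expWeight_of_pos ℓ κ _ k hz0, Finset.prod_mul_distrib, ← Real.exp_sum,
        Finset.sum_neg_distrib]
      have hexp : ∑ t, α t * ∑ q, x t q = ∑ q, (∑ t, α t • x t) q := by
        simp_rw [hzq, Finset.mul_sum]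
        exact Finset.sum_comm
      rw [hexp, ← mul_assoc]
      refine mul_le_mul_of_nonneg_right ?_ (Real.exp_pos _).le
      refine (prod_tableSum_rpow_le ℓ hκ hα hα1 k b hb β hβ hx).trans (le_of_eq ?_)
      rw [hB]
      ring
    -- Outside the positive orthant some factor on the left vanishes, and its exponent is positive.
    · push Not at hx
      obtain ⟨t, q, hq⟩ := hx
      rw [Finset.prod_eq_zero (Finset.mem_univ t)]
      · exact zero_le
      · rw [sum_prod_expWeight_of_nonpos _ hq, mul_zero, ENNReal.ofReal_zero,
          ENNReal.zero_rpow_of_pos (hα t)]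

/-- Indices of weight zero contribute `1` to the product, even if their count is zero, and nothing
to the averages. -/
theorem prod_card_edgeTables_rpow_le [Fintype τ] (ℓ : ι → σ) {κ : ι → ρ}
    (hκ : Function.Surjective κ) {α : τ → ℝ} (hα : ∀ t, 0 ≤ α t) (hα1 : ∑ t, α t = 1)
    (k : ρ → ℕ) (b : τ → σ → ℕ) (hb : ∀ t, ∑ s, b t s = ∑ c, k c) (β : σ → ℕ)
    (hβ : ∀ s, (β s : ℝ) = ∑ t, α t * b t s) :
    ∏ t, (((edgeTables ℓ κ (b t) k).card : ℝ) / min (vecOmega (b t)) (vecOmega k)) ^ α t ≤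
      omega (∑ c, k c) * (edgeTables ℓ κ β k).card / (vecOmega β * vecOmega k) := by
  classical
  have hmem : ∀ t, t ∈ Finset.univ.filter (0 < α ·) ↔ 0 < α t := by simp
  have hne : ∀ t, α t ≠ 0 → 0 < α t := fun t ht => (hα t).lt_of_ne' ht
  have hsum : ∀ g : τ → ℝ, ∑ t, α t * g t = ∑ t : {t // 0 < α t}, α t * g t := fun g => by
    rw [← Finset.sum_filter_of_ne (p := (0 < α ·)) fun t _ ht => hne t (left_ne_zero_of_mul ht)]
    exact Finset.sum_subtype _ hmem _
  have h := prod_card_edgeTables_rpow_le_of_pos ℓ hκ (α := fun t : {t // 0 < α t} => α t)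
    (fun t => t.2) (by simpa [hα1] using (hsum fun _ => 1).symm) k (fun t => b t)
    (fun t => hb t) β (fun s => (hβ s).trans (hsum _))
  refine le_trans (le_of_eq ?_) h
  rw [← Finset.prod_filter_of_ne (p := (0 < α ·)) fun t _ ht => hne t fun h0 => ht (by simp [h0])]
  exact Finset.prod_subtype _ hmem
    fun t => (((edgeTables ℓ κ (b t) k).card : ℝ) / min (vecOmega (b t)) (vecOmega k)) ^ α t

/-! ### Bounded tables as tables on a bipartite graph

The cell `(i, j)` of the matrix is joined to the row `i` and to the column `j`; the two edges carry
the entry and its complement in `K i j`. -/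

/-- The row or column at the end of an edge. -/
def lineNode (m n : ℕ) : (Fin m × Fin n) ⊕ (Fin m × Fin n) → Fin m ⊕ Fin n :=
  Sum.elim (fun c => Sum.inl c.1) (fun c => Sum.inr c.2)

/-- The cell at the end of an edge. -/
def cellNode (m n : ℕ) : (Fin m × Fin n) ⊕ (Fin m × Fin n) → Fin m × Fin n :=
  Sum.elim id id

theorem mem_edgeTables_node {m n : ℕ} {β : Fin m ⊕ Fin n → ℕ} {k : Fin m × Fin n → ℕ}
    {a : (Fin m × Fin n) ⊕ (Fin m × Fin n) → ℕ} :
    a ∈ edgeTables (lineNode m n) (cellNode m n) β k ↔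
      ((∀ i, ∑ j, a (.inl (i, j)) = β (.inl i)) ∧ ∀ j, ∑ i, a (.inr (i, j)) = β (.inr j)) ∧
        ∀ c, a (.inl c) + a (.inr c) = k c := by
  rw [mem_edgeTables]
  refine and_congr ?_ (forall_congr' fun c => ?_)
  · rw [fiberTables, Set.mem_ofPred_eq, Sum.forall]
    refine and_congr (forall_congr' fun i => ?_) (forall_congr' fun j => ?_)
    · rw [Finset.sum_filter, Fintype.sum_sum_type, Fintype.sum_prod_type]
      simp only [lineNode, Sum.elim_inl, Sum.elim_inr, Sum.inl.injEq, reduceCtorEq, if_false,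
        Finset.sum_const_zero, add_zero]
      rw [Finset.sum_eq_single i (fun i' _ hi => by simp [hi]) (by simp)]
      simp
    · rw [Finset.sum_filter, Fintype.sum_sum_type, Fintype.sum_prod_type_right
        (f := fun c : Fin m × Fin n => if lineNode m n (Sum.inr c) = _ then a (Sum.inr c) else 0)]
      simp only [lineNode, Sum.elim_inl, Sum.elim_inr, Sum.inr.injEq, reduceCtorEq, if_false,
        Finset.sum_const_zero, zero_add]
      rw [Finset.sum_eq_single j (fun j' _ hj => by simp [hj]) (by simp)]
      simp
  · have hc : ∀ e : Fin m × Fin n → (Fin m × Fin n) ⊕ (Fin m × Fin n),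
        (∀ x, cellNode m n (e x) = x) →
        (∑ x, if cellNode m n (e x) = c then a (e x) else 0) = a (e c) := fun e he => by
      rw [Finset.sum_eq_single c (fun x _ hx => if_neg (by rwa [he])) (by simp), if_pos (he c)]
    rw [Finset.sum_filter, Fintype.sum_sum_type, hc Sum.inl fun _ => rfl, hc Sum.inr fun _ => rfl]

/-- The bijection sends `A` to the pair `(A, K - A)`. The hypothesis on `C` makes the truncated
subtraction in `compl` a true one. -/
theorem numTables_eq_card {m n : ℕ} (K : Matrix (Fin m) (Fin n) ℕ) (R : Fin m → ℕ)
    (C : Fin n → ℕ) (hC : ∀ j, C j ≤ ∑ i, K i j) :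
    numTables K R C = (edgeTables (lineNode m n) (cellNode m n) (Sum.elim R (compl K C))
      fun c => K c.1 c.2).card := by
  rw [numTables, ← Set.ncard_coe_finset]
  refine Set.ncard_congr
    (fun A _ => Sum.elim (fun c => A c.1 c.2) (fun c => K c.1 c.2 - A c.1 c.2)) ?_ ?_ ?_
  · rintro A ⟨hR, hC', hK⟩
    rw [Finset.mem_coe, mem_edgeTables_node]
    refine ⟨⟨hR, fun j => ?_⟩, fun c => Nat.add_sub_cancel' (hK _ _)⟩
    simp only [Sum.elim_inr, compl, ← hC' j]
    exact Finset.sum_tsub_distrib _ fun i _ => hK i j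
  · intro A B _ _ hAB
    ext i j
    exact congrFun hAB (Sum.inl (i, j))
  · intro a ha
    rw [Finset.mem_coe, mem_edgeTables_node] at ha
    obtain ⟨⟨h1, h2⟩, h3⟩ := ha
    refine ⟨fun i j => a (.inl (i, j)), ⟨h1, fun j => ?_, fun i j => ?_⟩, ?_⟩
    · have h4 : ∑ i, a (.inl (i, j)) + ∑ i, a (.inr (i, j)) = ∑ i, K i j := by
        rw [← Finset.sum_add_distrib]
        exact Finset.sum_congr rfl fun i _ => h3 (i, j)
      have h5 := h2 j
      have h6 := hC j
      simp only [Sum.elim_inr, compl] at h5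
      change ∑ i, a (.inl (i, j)) = C j
      omega
    · have := h3 (i, j)
      simp only at this
      change a (.inl (i, j)) ≤ K i j
      omega
    · funext q
      rcases q with c | c
      · rfl
      · have := h3 c
        simp only [Sum.elim_inr, Prod.mk.eta]
        omega

end BoundedTables

/-! ### The theorem for bounded tables -/

theorem theorem1 {m n p : ℕ} (N : ℕ)
    (α : Fin p → ℝ) (hα : ∀ t, 0 ≤ α t) (hα1 : ∑ t, α t = 1)
    (Rt : Fin p → Fin m → ℕ) (Ct : Fin p → Fin n → ℕ)
    (hRt : ∀ t, ∑ i, Rt t i = N) (hCt : ∀ t, ∑ j, Ct t j = N)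
    (K : Matrix (Fin m) (Fin n) ℕ)
    (R : Fin m → ℕ) (hR : ∀ i, (R i : ℝ) = ∑ t, α t * (Rt t i : ℝ))
    (C : Fin n → ℕ) (hC : ∀ j, (C j : ℝ) = ∑ t, α t * (Ct t j : ℝ))
    (hK : ∀ t j, Ct t j ≤ ∑ i, K i j) :
    BoundedTables.omega (BoundedTables.matSum K) * (BoundedTables.numTables K R C : ℝ) /
        (BoundedTables.vecOmega R * BoundedTables.vecOmega (BoundedTables.compl K C) *
          BoundedTables.matOmega K) ≥
      ∏ t, ((BoundedTables.numTables K (Rt t) (Ct t) : ℝ) /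
        min (BoundedTables.vecOmega (Rt t) *
            BoundedTables.vecOmega (BoundedTables.compl K (Ct t)))
          (BoundedTables.matOmega K)) ^ (α t) := by
  open BoundedTables in
  have hCK : ∀ j, C j ≤ ∑ i, K i j := fun j => by
    have h : (C j : ℝ) ≤ ((∑ i, K i j : ℕ) : ℝ) := by
      rw [hC, ← one_mul ((∑ i, K i j : ℕ) : ℝ), ← hα1, Finset.sum_mul]
      exact Finset.sum_le_sum fun t _ =>
        mul_le_mul_of_nonneg_left (by exact_mod_cast hK t j) (hα t)
    exact_mod_cast h
  have hvec : ∀ (r : Fin m → ℕ) (c : Fin n → ℕ),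
      vecOmega (Sum.elim r c) = vecOmega r * vecOmega c := fun r c => by
    simp [vecOmega, Fintype.prod_sum_type]
  have hmat : vecOmega (fun c : Fin m × Fin n => K c.1 c.2) = matOmega K := by
    rw [vecOmega, matOmega, Fintype.prod_prod_type]
  have hsum : ∑ c : Fin m × Fin n, K c.1 c.2 = matSum K := by
    rw [matSum, Fintype.sum_prod_type]
  have h := prod_card_edgeTables_rpow_le (lineNode m n) (κ := cellNode m n)
    (fun c => ⟨Sum.inl c, rfl⟩) hα hα1 (fun c => K c.1 c.2)
    (fun t => Sum.elim (Rt t) (compl K (Ct t))) (fun t => ?_) (Sum.elim R (compl K C)) ?_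
  · simp_rw [← numTables_eq_card K _ _ (hK _)] at h
    simp only [hvec, hmat, hsum] at h
    rw [← numTables_eq_card K _ _ hCK] at h
    exact h
  -- The line margins total `N + (|K| - N) = |K|`, the total of the cell margins.
  · have h1 : ∑ j, Ct t j ≤ ∑ j, ∑ i, K i j := Finset.sum_le_sum fun j _ => hK t j
    have h2 : matSum K = ∑ j, ∑ i, K i j := Finset.sum_comm
    rw [Fintype.sum_sum_type, hsum, h2]
    simp only [Sum.elim_inl, Sum.elim_inr, BoundedTables.compl]
    rw [Finset.sum_tsub_distrib _ fun j _ => hK t j, hRt, hCt]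
    rw [hCt] at h1
    omega
  -- Complementation is affine and the weights sum to `1`, so the complemented column margins
  -- average in the same way.
  · rintro (i | j)
    · exact hR i
    · simp only [Sum.elim_inr, BoundedTables.compl]
      rw [Nat.cast_sub (hCK j), hC]
      simp_rw [fun t => Nat.cast_sub (R := ℝ) (hK t j), mul_sub]
      rw [Finset.sum_sub_distrib, ← Finset.sum_mul, hα1, one_mul]
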